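/- Let $k$ be a field, $G$ a finite group, and $V$ a (left) Yetter–Drinfeld module over the group algebra $kG$, with action $g\cdot v$ and coaction $v\mapsto\sum v_{(-1)}\otimes v_{(0)}$, where $\rho(g\cdot v)=\sum g v_{(-1)}g^{-1}\otimes g\cdot v_{(0)}$. The coaction is the same as a $G$-grading, in which $v$ has degree $g$ if and only if $v\mapsto g\otimes v$. Let $B(V)=T(V)/I(V)$ be the Nichols algebra of $V$: here $T(V)$ is the braided Hopf algebra in which every $v\in V$ is primitive, for the braiding $c(v\otimes w)=\sum v_{(-1)}\cdot w\otimes v_{(0)}$, and $I(V)$ is the largest (two-sided) ideal that is homogeneous and generated in degrees $\ge 2$, a Yetter–Drinfeld submodule, and a coideal. Write $\Delta(r)=\sum r^1\otimes r^2$ for the comultiplication of $B(V)$, and let $B(V)\#kG$ be its bosonization, i.e. the vector space $B(V)\otimes kG$ with $$(r\#g)(r'\#g')=r(g\cdot r')\#gg',\qquad \Delta(r\#g)=\sum r^1\#(r^2)_{(-1)}g\otimes (r^2)_{(0)}\#g,\qquad \varepsilon(r\#g)=\varepsilon(r).$$ For a coalgebra $C$ with a grouplike element $1$, let $C^+=\operatorname{Ker}\varepsilon$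 and $\overline\Delta\colon C^+\to C^+\otimes C^+$, $\overline\Delta(r)=\Delta(r)-r\otimes 1-1\otimes r$. The cobar construction is the differential graded algebra $\Omega C=T(C^+)$ with differential $$\partial^n=\sum_{i=0}^{n-1}(-1)^{i+1}\,1^{\otimes i}\otimes\overline\Delta\otimes 1^{\otimes (n-i-1)}\colon (C^+)^{\otimes n}\to (C^+)^{\otimes (n+1)},$$ and $H^n(\Omega C)=\operatorname{Ker}\partial^n/\operatorname{Im}\partial^{n-1}$ (with $\partial^{-1}=0$). Then $\bigoplus_{n\ge0}H^n(\Omega C)$ is a graded algebra. The coaction of $kG$ on $B(V)$ extends diagonally to $\Omega B(V)$ and makes $\bigoplus_{n\ge 0} H^n(\Omega B(V))$ a $G$-graded algebra; $H^n(\Omega B(V))^{\mathrm{co}\,G}$ denotes the part of $H^n(\Omega B(V))$ of trivial $G$-grading. If $B(V)$ is finite-dimensional, then there is an isomorphism of $k$-algebras $$\bigoplus_{n\ge0}H^n\big(\Omega(B(V)\#kG)\big)\;\cong\;\bigoplus_{n\ge0}H^n\big(\Omega B(V)\big)^{\mathrm{co}\,G}$$ that restricts to an isomorphism $H^n(\Omega(B(V)\#kG))\cong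 H^n(\Omega B(V))^{\mathrm{co}\,G}$ for every $n\ge 0$. -/

import Mathlib

open scoped TensorProduct

noncomputable section

/-- A left comodule over the group algebra `k[G]`. -/
class GroupComodule (k G V : Type*) [Field k] [Group G] [AddCommGroup V] [Module k V] where
  /-- The coaction `v ↦ ∑ v₍₋₁₎ ⊗ v₍₀₎`. -/
  coact : V →ₗ[k] MonoidAlgebra k G ⊗[k] V
  coassoc : (TensorProduct.assoc k _ _ _).toLinearMap ∘ₗ
      (Coalgebra.comul (R := k) (A := MonoidAlgebra k G)).rTensor V ∘ₗ coact =
    coact.lTensor (MonoidAlgebra k G) ∘ₗ coact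
  counit : (TensorProduct.lid k V).toLinearMap ∘ₗ
      (Coalgebra.counit (R := k) (A := MonoidAlgebra k G)).rTensor V ∘ₗ coact = LinearMap.id

/-- A left Yetter-Drinfeld module over `k[G]`. -/
class YetterDrinfeld (k G V : Type*) [Field k] [Group G] [AddCommGroup V] [Module k V]
    extends GroupComodule k G V where
  /-- The action of `G`. -/
  act : Representation k G V
  compat : ∀ (g : G) (v : V), coact (act g v) =
    TensorProduct.map
      (LinearMap.mulLeftRight k (MonoidAlgebra.single g (1 : k), MonoidAlgebra.single g⁻¹ (1 : k)))
      (act g) (coact v)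

namespace GroupComodule

theorem exists_finsupp_repr {k G V : Type*} [Field k] [AddCommGroup V] [Module k V]
    (t : MonoidAlgebra k G ⊗[k] V) :
    ∃ f : G →₀ V, t = f.sum fun g v => MonoidAlgebra.single g (1 : k) ⊗ₜ[k] v := by
  induction t with
  | zero => exact ⟨0, by simp⟩
  | add x y hx hy =>
    obtain ⟨f, rfl⟩ := hx
    obtain ⟨f', rfl⟩ := hy
    refine ⟨f + f', ?_⟩
    rw [Finsupp.sum_add_index'] <;> simp [TensorProduct.tmul_add]
  | tmul a v =>
    induction a using MonoidAlgebra.induction_linear with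
    | zero => exact ⟨0, by simp⟩
    | add x y hx hy =>
      obtain ⟨f, hf⟩ := hx
      obtain ⟨f', hf'⟩ := hy
      refine ⟨f + f', ?_⟩
      rw [TensorProduct.add_tmul, hf, hf', Finsupp.sum_add_index'] <;>
        simp [TensorProduct.tmul_add]
    | single g r =>
      refine ⟨Finsupp.single g (r • v), ?_⟩
      rw [Finsupp.sum_single_index (by simp), TensorProduct.tmul_smul, TensorProduct.smul_tmul']
      simp

section Comodule
variable (k G V : Type*) [Field k] [Group G] [AddCommGroup V] [Module k V] [GroupComodule k G V]

/-- The homogeneous part `V_g = {v | ρ(v) = g ⊗ v}` of `G`-grading `g`. -/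
def degreePart (g : G) : Submodule k V :=
  LinearMap.ker (coact (k := k) (G := G) (V := V) -
    TensorProduct.mk k (MonoidAlgebra k G) V (MonoidAlgebra.single g 1))

variable {k G V}

theorem mem_degreePart {g : G} {v : V} : v ∈ degreePart k G V g ↔
    coact (k := k) (G := G) v = MonoidAlgebra.single g (1 : k) ⊗ₜ[k] v := by
  simp [degreePart, sub_eq_zero]

theorem of_coact_eq_sum {v : V} {s : Finset G} {w : G → V}
    (hv : coact (k := k) v = ∑ g ∈ s, MonoidAlgebra.single g (1 : k) ⊗ₜ[k] w g) :
    (∀ g ∈ s, w g ∈ degreePart k G V g) ∧ v = ∑ g ∈ s, w g := by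
  have h1 := LinearMap.congr_fun (counit (k := k) (G := G) (V := V)) v
  have h2 := LinearMap.congr_fun (coassoc (k := k) (G := G) (V := V)) v
  simp only [LinearMap.comp_apply, hv, map_sum, LinearMap.rTensor_tmul,
    LinearMap.lTensor_tmul, LinearEquiv.coe_coe, TensorProduct.lid_tmul,
    MonoidAlgebra.counit_single, MonoidAlgebra.comul_single, CommSemiring.counit_apply, one_smul,
    CommSemiring.comul_apply, TensorProduct.map_tmul, TensorProduct.assoc_tmul,
    LinearMap.id_apply, MonoidAlgebra.lsingle_apply] at h1 h2
  refine ⟨fun g hg => ?_, h1.symm⟩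
  rw [mem_degreePart]
  have h3 := congrArg ((TensorProduct.lid k (MonoidAlgebra k G ⊗[k] V)).toLinearMap ∘ₗ
    LinearMap.rTensor (MonoidAlgebra k G ⊗[k] V)
    (Finsupp.lapply g ∘ₗ (MonoidAlgebra.coeffLinearEquiv k).toLinearMap)) h2
  classical
  simp only [map_sum, LinearMap.comp_apply, LinearMap.rTensor_tmul, LinearEquiv.coe_coe,
    MonoidAlgebra.coeffLinearEquiv_apply, MonoidAlgebra.coeff_single, Finsupp.lapply_apply,
    Finsupp.single_apply, TensorProduct.lid_tmul, ite_smul, one_smul, zero_smul,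
    Finset.sum_ite_eq', hg, if_true] at h3
  exact h3.symm

variable (k G V) in
theorem iSup_degreePart : ⨆ g, degreePart k G V g = ⊤ := by
  rw [eq_top_iff]
  intro v _
  obtain ⟨f, hf⟩ := exists_finsupp_repr (coact (k := k) (G := G) v)
  obtain ⟨h, hv⟩ := of_coact_eq_sum hf
  rw [hv]
  exact Submodule.sum_mem _ fun g hg => Submodule.mem_iSup_of_mem g (h g hg)
end Comodule

section
variable {k G V W : Type*} [Field k] [Group G] [AddCommGroup V] [Module k V] [GroupComodule k G V]
  [AddCommGroup W] [Module k W]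

variable (k G) in
theorem hom_induction {P : V → Prop} (h0 : P 0) (hadd : ∀ x y, P x → P y → P (x + y))
    (h : ∀ (g : G) (v : V), v ∈ degreePart k G V g → P v) (v : V) : P v := by
  have hv : v ∈ ⨆ g, degreePart k G V g := by rw [iSup_degreePart]; trivial
  induction hv using Submodule.iSup_induction' with
  | mem g x hx => exact h g x hx
  | zero => exact h0
  | add x y _ _ hx hy => exact hadd x y hx hy

variable (k G) in
theorem linearMap_ext {f f' : V →ₗ[k] W}
    (h : ∀ (g : G) (v : V), v ∈ degreePart k G V g → f v = f' v) : f = f' :=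
  LinearMap.ext fun v => hom_induction k G (P := fun v => f v = f' v) (by simp)
    (fun x y hx hy => by simp [hx, hy]) h v
end

end GroupComodule


namespace YetterDrinfeld
open GroupComodule

section
variable {k G V W : Type*} [Field k] [Group G] [AddCommGroup V] [Module k V] [YetterDrinfeld k G V]
  [AddCommGroup W] [Module k W] [YetterDrinfeld k G W]

theorem act_mem {g h : G} {v : V} (hv : v ∈ degreePart k G V h) :
    act (k := k) g v ∈ degreePart k G V (g * h * g⁻¹) := by
  rw [mem_degreePart] at hv ⊢
  rw [compat, hv]
  simp

variable (k G V W) in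
/-- The braiding `c(v ⊗ w) = v₍₋₁₎ · w ⊗ v₍₀₎`. -/
def braiding : V ⊗[k] W →ₗ[k] W ⊗[k] V :=
  TensorProduct.map
      (TensorProduct.lift (act (k := k) (G := G) (V := W)).asAlgebraHom.toLinearMap) LinearMap.id ∘ₗ
    (TensorProduct.rightComm k (MonoidAlgebra k G) V W).toLinearMap ∘ₗ
    TensorProduct.map (coact (k := k) (G := G) (V := V)) LinearMap.id

theorem braiding_tmul {g : G} {v : V} (hv : v ∈ degreePart k G V g) (w : W) :
    braiding k G V W (v ⊗ₜ w) = act (k := k) g w ⊗ₜ v := by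
  rw [mem_degreePart] at hv
  simp [braiding, hv]

end

section
variable (k G V W : Type*) [Field k] [Group G] [AddCommGroup V] [Module k V] [GroupComodule k G V]
  [AddCommGroup W] [Module k W] [GroupComodule k G W]

/-- The coaction `v ⊗ w ↦ v₍₋₁₎ w₍₋₁₎ ⊗ (v₍₀₎ ⊗ w₍₀₎)` on a tensor product. -/
def coactTensor : V ⊗[k] W →ₗ[k] MonoidAlgebra k G ⊗[k] (V ⊗[k] W) :=
  TensorProduct.map (LinearMap.mul' k (MonoidAlgebra k G)) LinearMap.id ∘ₗ
    (TensorProduct.tensorTensorTensorComm k _ _ _ _).toLinearMap ∘ₗ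
    TensorProduct.map (coact (k := k) (G := G) (V := V)) (coact (k := k) (G := G) (V := W))

variable {k G V W} in
theorem coactTensor_tmul {g h : G} {v : V} {w : W} (hv : v ∈ degreePart k G V g)
    (hw : w ∈ degreePart k G W h) :
    coactTensor k G V W (v ⊗ₜ w) = MonoidAlgebra.single (g * h) (1 : k) ⊗ₜ (v ⊗ₜ w) := by
  rw [mem_degreePart] at hv hw
  simp [coactTensor, hv, hw]
end

section
variable (k G A : Type*) [Field k] [Group G] [Ring A] [Algebra k A] [YetterDrinfeld k G A]

/-- The multiplication `(m ⊗ m)(id ⊗ c ⊗ id)` of the braided tensor square of `A`, that is,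
`(a ⊗ b)(a' ⊗ b') = a (b₍₋₁₎ · a') ⊗ b₍₀₎ b'`. -/
def braidedMul : (A ⊗[k] A) ⊗[k] (A ⊗[k] A) →ₗ[k] A ⊗[k] A :=
  TensorProduct.map (LinearMap.mul' k A) (LinearMap.mul' k A) ∘ₗ
    (TensorProduct.assoc k A A (A ⊗[k] A)).symm.toLinearMap ∘ₗ
    ((TensorProduct.assoc k A A A).toLinearMap ∘ₗ
      (braiding k G A A).rTensor A ∘ₗ
      (TensorProduct.assoc k A A A).symm.toLinearMap).lTensor A ∘ₗ
    (TensorProduct.assoc k A A (A ⊗[k] A)).toLinearMap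

variable {k G A} in
theorem braidedMul_tmul {g : G} {b : A} (hb : b ∈ degreePart k G A g) (a a' b' : A) :
    braidedMul k G A ((a ⊗ₜ b) ⊗ₜ (a' ⊗ₜ b')) = (a * act (k := k) g a') ⊗ₜ (b * b') := by
  simp [braidedMul, braiding_tmul hb]

/-- The axioms of a bialgebra in the category of Yetter-Drinfeld modules over `k[G]`: the algebra
and coalgebra structure maps are morphisms of Yetter-Drinfeld modules, and the comultiplication
and counit are algebra maps for the braided product on `A ⊗ A`. -/
class BraidedBialgebra [Coalgebra k A] : Prop where
  act_one : ∀ g : G, act (k := k) g (1 : A) = 1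
  act_mul : ∀ (g : G) (a b : A), act (k := k) g (a * b) = act (k := k) g a * act (k := k) g b
  coact_one : coact (k := k) (G := G) (1 : A) = 1
  coact_mul : ∀ a b : A, coact (k := k) (G := G) (a * b) =
    coact (k := k) (G := G) a * coact (k := k) (G := G) b
  comul_act : ∀ (g : G) (a : A), Coalgebra.comul (R := k) (act (k := k) g a) =
    TensorProduct.map (act (k := k) g) (act (k := k) g) (Coalgebra.comul (R := k) a)
  counit_act : ∀ (g : G) (a : A),
    Coalgebra.counit (R := k) (act (k := k) g a) = Coalgebra.counit (R := k) a
  coact_comul : ∀ a : A, coactTensor k G A A (Coalgebra.comul (R := k) a) =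
    (Coalgebra.comul (R := k)).lTensor _ (coact (k := k) (G := G) a)
  coact_counit : ∀ a : A, (TensorProduct.rid k _) ((Coalgebra.counit (R := k)).lTensor _
    (coact (k := k) (G := G) a)) = Coalgebra.counit (R := k) a • (1 : MonoidAlgebra k G)
  comul_one : Coalgebra.comul (R := k) (1 : A) = 1 ⊗ₜ 1
  comul_mul : ∀ a b : A, Coalgebra.comul (R := k) (a * b) =
    braidedMul k G A (Coalgebra.comul (R := k) a ⊗ₜ Coalgebra.comul (R := k) b)
  counit_one : Coalgebra.counit (R := k) (1 : A) = 1
  counit_mul : ∀ a b : A, Coalgebra.counit (R := k) (a * b) =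
    Coalgebra.counit (R := k) a * Coalgebra.counit (R := k) b
end
end YetterDrinfeld

section TensorAlgComodule
open GroupComodule
variable (k G V : Type*) [Field k] [Group G] [AddCommGroup V] [Module k V] [GroupComodule k G V]

/-- The diagonal coaction of `k[G]` on `T(V)`, an algebra map. -/
def TensorAlgebra.coactHom : TensorAlgebra k V →ₐ[k] MonoidAlgebra k G ⊗[k] TensorAlgebra k V :=
  TensorAlgebra.lift k ((TensorAlgebra.ι k).lTensor _ ∘ₗ coact (k := k) (G := G) (V := V))

instance TensorAlgebra.groupComodule : GroupComodule k G (TensorAlgebra k V) where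
  coact := (TensorAlgebra.coactHom k G V).toLinearMap
  coassoc := by
    have : ((Algebra.TensorProduct.assoc k k k _ _ _).toAlgHom.comp
        (Algebra.TensorProduct.map (Bialgebra.comulAlgHom k (MonoidAlgebra k G))
          (AlgHom.id k (TensorAlgebra k V)))).comp (TensorAlgebra.coactHom k G V) =
        (Algebra.TensorProduct.map (AlgHom.id k _) (TensorAlgebra.coactHom k G V)).comp
          (TensorAlgebra.coactHom k G V) := by
      apply TensorAlgebra.hom_ext
      apply linearMap_ext k G
      intro g v hv
      rw [mem_degreePart] at hv
      simp [TensorAlgebra.coactHom, hv]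
    exact congrArg AlgHom.toLinearMap this
  counit := by
    have : ((Algebra.TensorProduct.lid k _).toAlgHom.comp
        (Algebra.TensorProduct.map (Bialgebra.counitAlgHom k (MonoidAlgebra k G))
          (AlgHom.id k (TensorAlgebra k V)))).comp (TensorAlgebra.coactHom k G V) =
        AlgHom.id k _ := by
      apply TensorAlgebra.hom_ext
      apply linearMap_ext k G
      intro g v hv
      rw [mem_degreePart] at hv
      simp [TensorAlgebra.coactHom, hv]
    exact congrArg AlgHom.toLinearMap this

namespace TensorAlgebra
variable {k G V}

theorem coact_mul (x y : TensorAlgebra k V) :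
    coact (k := k) (G := G) (x * y) = coact (k := k) (G := G) x * coact (k := k) (G := G) y :=
  map_mul (coactHom k G V) x y

theorem coact_one : coact (k := k) (G := G) (1 : TensorAlgebra k V) = 1 :=
  map_one (coactHom k G V)

theorem coact_ι (v : V) : coact (k := k) (G := G) (ι k v) =
    (ι k).lTensor _ (coact (k := k) (G := G) v) := by
  change coactHom k G V (ι k v) = _
  simp [coactHom]

theorem ι_mem {g : G} {v : V} (hv : v ∈ degreePart k G V g) :
    ι k v ∈ degreePart k G (TensorAlgebra k V) g := by
  rw [mem_degreePart] at *
  simp [coact_ι, hv]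

theorem mul_mem {g h : G} {x y : TensorAlgebra k V}
    (hx : x ∈ degreePart k G _ g) (hy : y ∈ degreePart k G _ h) :
    x * y ∈ degreePart k G (TensorAlgebra k V) (g * h) := by
  rw [mem_degreePart] at *
  simp [coact_mul, hx, hy]

variable (k G) in
theorem induction_hom {P : TensorAlgebra k V → Prop} (h1 : P 1)
    (hsmul : ∀ (r : k) x, P x → P (r • x)) (hadd : ∀ x y, P x → P y → P (x + y))
    (hmul : ∀ (g : G) (v : V) (x), v ∈ degreePart k G V g → P x → P (ι k v * x))
    (x : TensorAlgebra k V) : P x := by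
  suffices h : ∀ y, P y → P (x * y) by simpa using h 1 h1
  have h0 : P 0 := by simpa using hsmul 0 1 h1
  induction x using TensorAlgebra.induction with
  | algebraMap r => intro y hy; rw [← Algebra.smul_def]; exact hsmul r y hy
  | ι v =>
    intro y hy
    induction v using hom_induction k G (V := V) with
    | h0 => simpa using h0
    | hadd v w hv hw => rw [map_add, add_mul]; exact hadd _ _ hv hw
    | h g v hv => exact hmul g v y hv hy
  | mul a b ha hb => intro y hy; rw [mul_assoc]; exact ha _ (hb _ hy)
  | add a b ha hb => intro y hy; rw [add_mul]; exact hadd _ _ (ha _ hy) (hb _ hy)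

variable (k G V) in
theorem one_mem : (1 : TensorAlgebra k V) ∈ degreePart k G (TensorAlgebra k V) (1 : G) := by
  rw [mem_degreePart, coact_one]; rfl

end TensorAlgebra
end TensorAlgComodule

section TensorAlg
open GroupComodule YetterDrinfeld
variable (k G V : Type*) [Field k] [Group G] [AddCommGroup V] [Module k V] [YetterDrinfeld k G V]

/-- The diagonal action of `G` on `T(V)` by algebra automorphisms. -/
def TensorAlgebra.actHom (g : G) : TensorAlgebra k V →ₐ[k] TensorAlgebra k V :=
  TensorAlgebra.lift k (TensorAlgebra.ι k ∘ₗ act (k := k) g)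

/-- The action of `G` on `T(V)` as a representation. -/
def TensorAlgebra.actRep : Representation k G (TensorAlgebra k V) where
  toFun := fun g => (TensorAlgebra.actHom k G V g).toLinearMap
  map_one' := by
    have : TensorAlgebra.actHom k G V 1 = AlgHom.id k _ := by
      apply TensorAlgebra.hom_ext
      ext v
      simp [TensorAlgebra.actHom]
    exact congrArg AlgHom.toLinearMap this
  map_mul' := fun g h => by
    have : TensorAlgebra.actHom k G V (g * h) =
        (TensorAlgebra.actHom k G V g).comp (TensorAlgebra.actHom k G V h) := by
      apply TensorAlgebra.hom_ext
      ext v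
      simp [TensorAlgebra.actHom]
    exact congrArg AlgHom.toLinearMap this

theorem MonoidAlgebra.mulLeftRight_eq (g : G) :
    (LinearMap.mulLeftRight k (MonoidAlgebra.single g (1 : k), MonoidAlgebra.single g⁻¹ (1 : k)) :
      MonoidAlgebra k G →ₗ[k] MonoidAlgebra k G) =
    (MonoidAlgebra.mapDomainAlgHom k k (MulAut.conj g).toMonoidHom).toLinearMap := by
  ext h
  simp

instance TensorAlgebra.yetterDrinfeld : YetterDrinfeld k G (TensorAlgebra k V) where
  act := TensorAlgebra.actRep k G V
  compat := fun g x => by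
    have : (TensorAlgebra.coactHom k G V).comp (TensorAlgebra.actHom k G V g) =
        (Algebra.TensorProduct.map
          (MonoidAlgebra.mapDomainAlgHom k k (MulAut.conj g).toMonoidHom)
          (TensorAlgebra.actHom k G V g)).comp (TensorAlgebra.coactHom k G V) := by
      apply TensorAlgebra.hom_ext
      apply linearMap_ext k G
      intro h v hv
      have hv' := act_mem (g := g) hv
      rw [mem_degreePart] at hv hv'
      simp [TensorAlgebra.coactHom, TensorAlgebra.actHom, hv, hv']
    rw [MonoidAlgebra.mulLeftRight_eq]
    exact AlgHom.congr_fun this x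

namespace TensorAlgebra

variable {k G V}

theorem act_mul (g : G) (x y : TensorAlgebra k V) :
    act (k := k) g (x * y) = act (k := k) g x * act (k := k) g y :=
  map_mul (actHom k G V g) x y

theorem act_one (g : G) : act (k := k) g (1 : TensorAlgebra k V) = 1 :=
  map_one (actHom k G V g)

theorem act_ι (g : G) (v : V) : act (k := k) g (ι k v) = ι k (act (k := k) g v) := by
  change actHom k G V g (ι k v) = _
  simp [actHom]

variable (k G V)

/-- Left multiplication by `v ⊗ 1 + 1 ⊗ v` in the braided tensor square of `T(V)`. -/
def primMul : V →ₗ[k] Module.End k (TensorAlgebra k V ⊗[k] TensorAlgebra k V) :=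
  TensorProduct.curry (braidedMul k G (TensorAlgebra k V)) ∘ₗ
    ((TensorProduct.mk k _ _).flip 1 ∘ₗ ι k + TensorProduct.mk k _ _ 1 ∘ₗ ι k)

/-- The comultiplication of `T(V)`: the map with `Δ(v₁ ⋯ vₙ) = Δ(v₁) ⋯ Δ(vₙ)`, where
`Δ(v) = v ⊗ 1 + 1 ⊗ v` and the product is that of the braided tensor square of `T(V)`. -/
def braidedComul : TensorAlgebra k V →ₗ[k] TensorAlgebra k V ⊗[k] TensorAlgebra k V :=
  LinearMap.applyₗ (1 ⊗ₜ 1) ∘ₗ (lift k (primMul k G V)).toLinearMap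

variable {k G V}

theorem primMul_tmul {g : G} {v : V} (hv : v ∈ degreePart k G V g) (x y : TensorAlgebra k V) :
    primMul k G V v (x ⊗ₜ y) = (ι k v * x) ⊗ₜ y + act (k := k) g x ⊗ₜ (ι k v * y) := by
  have h1 := braidedMul_tmul (one_mem k G V) (ι k v) x y
  have hι := ι_mem hv
  have h2 := braidedMul_tmul hι 1 x y
  rw [map_one, Module.End.one_apply, one_mul] at h1
  rw [one_mul] at h2
  rw [← h1, ← h2, ← map_add, ← TensorProduct.add_tmul]
  rfl

variable (k G V) in
theorem braidedComul_one : braidedComul k G V 1 = 1 ⊗ₜ 1 := by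
  simp [braidedComul]

theorem braidedComul_ι_mul (v : V) (x : TensorAlgebra k V) :
    braidedComul k G V (ι k v * x) = primMul k G V v (braidedComul k G V x) := by
  simp [braidedComul]

theorem braidedComul_ι (v : V) :
    braidedComul k G V (ι k v) = ι k v ⊗ₜ 1 + 1 ⊗ₜ ι k v := by
  rw [← mul_one (ι k v), braidedComul_ι_mul, braidedComul_one, mul_one]
  induction v using hom_induction k G (V := V) with
  | h0 => simp
  | hadd x y hx hy =>
    simp only [map_add, LinearMap.add_apply, TensorProduct.add_tmul, TensorProduct.tmul_add, hx, hy]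
    abel
  | h g v hv => simp [primMul_tmul hv, act_one]

theorem braidedComul_act (h : G) (x : TensorAlgebra k V) :
    braidedComul k G V (act (k := k) h x) =
      TensorProduct.map (act (k := k) h) (act (k := k) h) (braidedComul k G V x) := by
  induction x using induction_hom k G (V := V) with
  | h1 => simp [act_one, braidedComul_one]
  | hsmul r x hx => simp [hx]
  | hadd x y hx hy => simp [hx, hy]
  | hmul g v x hv hx =>
    rw [act_mul, act_ι, braidedComul_ι_mul, braidedComul_ι_mul, hx]
    generalize braidedComul k G V x = t
    induction t with
    | zero => simp
    | add a b ha hb => simp only [map_add, ha, hb]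
    | tmul a b =>
      rw [TensorProduct.map_tmul, primMul_tmul (act_mem hv), primMul_tmul hv, map_add,
        TensorProduct.map_tmul, TensorProduct.map_tmul, act_mul, act_mul, act_ι]
      simp [← Module.End.mul_apply, ← map_mul]

theorem braidedComul_coact (x : TensorAlgebra k V) :
    coactTensor k G _ _ (braidedComul k G V x) =
      (braidedComul k G V).lTensor _ (coact (k := k) (G := G) x) := by
  induction x using induction_hom k G (V := V) with
  | h1 => simp [coact_one, braidedComul_one, coactTensor_tmul (one_mem k G V) (one_mem k G V),
      Algebra.TensorProduct.one_def, MonoidAlgebra.one_def]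
  | hsmul r x hx => simp [hx]
  | hadd x y hx hy => simp [hx, hy]
  | hmul g v x hv hx =>
    have key : ∀ t, coactTensor k G _ _ (primMul k G V v t) =
        TensorProduct.map (LinearMap.mulLeft k (MonoidAlgebra.single g (1 : k)))
          (primMul k G V v) (coactTensor k G _ _ t) := by
      intro t
      induction t with
      | zero => simp
      | add a b ha hb => simp only [map_add, ha, hb]
      | tmul a b =>
        induction a using hom_induction k G (V := TensorAlgebra k V) with
        | h0 => simp
        | hadd x y hx hy => simp only [map_add, TensorProduct.add_tmul, hx, hy]
        | h s a ha =>
          induction b using hom_induction k G (V := TensorAlgebra k V) with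
          | h0 => simp
          | hadd x y hx hy => simp only [map_add, TensorProduct.tmul_add, hx, hy]
          | h t b hb =>
            rw [primMul_tmul hv, map_add, coactTensor_tmul (mul_mem (ι_mem hv) ha) hb,
              coactTensor_tmul (act_mem ha) (mul_mem (ι_mem hv) hb), coactTensor_tmul ha hb]
            simp [primMul_tmul hv, TensorProduct.tmul_add, mul_assoc]
    rw [braidedComul_ι_mul, key, hx, coact_mul, mem_degreePart.1 (ι_mem hv)]
    generalize coact (k := k) (G := G) x = t
    induction t with
    | zero => simp
    | add a b ha hb => simp only [map_add, mul_add, ha, hb]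
    | tmul a b => simp [braidedComul_ι_mul]

theorem braidedComul_mul (x y : TensorAlgebra k V) :
    braidedComul k G V (x * y) =
      braidedMul k G _ (braidedComul k G V x ⊗ₜ braidedComul k G V y) := by
  induction x using induction_hom k G (V := V) with
  | h1 =>
    rw [braidedComul_one, one_mul]
    generalize braidedComul k G V y = t
    induction t with
    | zero => simp
    | add a b ha hb => simpa only [map_add, TensorProduct.tmul_add] using congrArg₂ (· + ·) ha hb
    | tmul a b =>
      rw [braidedMul_tmul (one_mem k G V), map_one, Module.End.one_apply,
        one_mul, one_mul]
  | hsmul r x hx => simp only [smul_mul_assoc, map_smul, hx, ← TensorProduct.smul_tmul']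
  | hadd x y hx hy => simp [hx, hy, add_mul, TensorProduct.add_tmul]
  | hmul g v x hv hx =>
    rw [mul_assoc, braidedComul_ι_mul, braidedComul_ι_mul, hx]
    generalize braidedComul k G V x = s
    generalize braidedComul k G V y = t
    induction s with
    | zero => simp
    | add a b ha hb => simp only [map_add, TensorProduct.add_tmul, ha, hb]
    | tmul a b =>
      induction b using hom_induction k G (V := TensorAlgebra k V) with
      | h0 => simp
      | hadd x y hx hy => simp only [map_add, TensorProduct.tmul_add, TensorProduct.add_tmul, hx, hy]
      | h s b hb =>
        induction t with
        | zero => simp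
        | add c d hc hd => simp only [map_add, TensorProduct.tmul_add, hc, hd]
        | tmul c d =>
          have hm := mul_mem (ι_mem hv) hb
          rw [braidedMul_tmul hb, primMul_tmul hv, primMul_tmul hv, TensorProduct.add_tmul,
            map_add, braidedMul_tmul hb, braidedMul_tmul hm, act_mul]
          simp [mul_assoc]


variable (k G V) in
/-- Left multiplication by `v ⊗ 1 ⊗ 1 + 1 ⊗ v ⊗ 1 + 1 ⊗ 1 ⊗ v` in the braided tensor cube. -/
def primMul₃ (g : G) (v : V) :
    Module.End k (TensorAlgebra k V ⊗[k] (TensorAlgebra k V ⊗[k] TensorAlgebra k V)) :=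
  TensorProduct.map (LinearMap.mulLeft k (ι k v)) LinearMap.id +
    TensorProduct.map (act (k := k) g) (primMul k G V v)

theorem primMul₃_tmul (g : G) (v : V) (x : TensorAlgebra k V)
    (t : TensorAlgebra k V ⊗[k] TensorAlgebra k V) :
    primMul₃ k G V g v (x ⊗ₜ t) =
      (ι k v * x) ⊗ₜ t + act (k := k) g x ⊗ₜ primMul k G V v t := rfl

theorem braidedComul_coassoc (x : TensorAlgebra k V) :
    TensorProduct.assoc k _ _ _ ((braidedComul k G V).rTensor _ (braidedComul k G V x)) =
      (braidedComul k G V).lTensor _ (braidedComul k G V x) := by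
  induction x using induction_hom k G (V := V) with
  | h1 => simp [braidedComul_one]
  | hsmul r x hx => simp [hx]
  | hadd x y hx hy => simp only [map_add, hx, hy]
  | hmul g v x hv hx =>
    have hA : ∀ t, TensorProduct.assoc k _ _ _ ((braidedComul k G V).rTensor _
        (primMul k G V v t)) = primMul₃ k G V g v (TensorProduct.assoc k _ _ _ ((braidedComul k G V).rTensor _ t)) := by
      intro t
      induction t with
      | zero => simp
      | add a b ha hb => simp only [map_add, ha, hb]
      | tmul x y =>
        rw [primMul_tmul hv, map_add, LinearMap.rTensor_tmul, LinearMap.rTensor_tmul,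
          LinearMap.rTensor_tmul, braidedComul_ι_mul, braidedComul_act]
        generalize braidedComul k G V x = s
        induction s with
        | zero => simp
        | add a b ha hb =>
          simp only [map_add, TensorProduct.add_tmul] at ha hb ⊢
          rw [← ha, ← hb]
          abel
        | tmul a b =>
          simp only [primMul_tmul hv, TensorProduct.add_tmul, map_add, TensorProduct.assoc_tmul,
            TensorProduct.map_tmul, primMul₃_tmul, TensorProduct.tmul_add]
          abel
    have hB : ∀ t, (braidedComul k G V).lTensor _ (primMul k G V v t) =
        primMul₃ k G V g v ((braidedComul k G V).lTensor _ t) := by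
      intro t
      induction t with
      | zero => simp
      | add a b ha hb => simp only [map_add, ha, hb]
      | tmul x y => simp [primMul_tmul hv, primMul₃_tmul, braidedComul_ι_mul]
    rw [braidedComul_ι_mul, hA, hB, hx]

theorem algebraMapInv_act (g : G) (x : TensorAlgebra k V) :
    algebraMapInv (act (k := k) g x) = algebraMapInv x := by
  have : (algebraMapInv (R := k) (M := V)).comp (actHom k G V g) = algebraMapInv := by
    ext v
    simp [actHom, algebraMapInv]
  exact AlgHom.congr_fun this x

theorem algebraMapInv_ι (v : V) : algebraMapInv (ι k v) = 0 := by simp [algebraMapInv]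

theorem coact_algebraMapInv (x : TensorAlgebra k V) :
    (TensorProduct.rid k _) (algebraMapInv.toLinearMap.lTensor _ (coact (k := k) (G := G) x)) =
      algebraMapInv x • (1 : MonoidAlgebra k G) := by
  rw [← Algebra.algebraMap_eq_smul_one]
  have : (Algebra.TensorProduct.rid k k _).toAlgHom.comp ((Algebra.TensorProduct.map
      (AlgHom.id k (MonoidAlgebra k G)) (algebraMapInv (R := k) (M := V))).comp
        (coactHom k G V)) = (Algebra.ofId k _).comp algebraMapInv := by
    apply TensorAlgebra.hom_ext
    apply linearMap_ext k G
    intro g v hv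
    rw [mem_degreePart] at hv
    simp [coactHom, hv, algebraMapInv]
  exact AlgHom.congr_fun this x

theorem counit_braidedComul (x : TensorAlgebra k V) :
    algebraMapInv.toLinearMap.rTensor _ (braidedComul k G V x) = (1 : k) ⊗ₜ[k] x := by
  induction x using induction_hom k G (V := V) with
  | h1 => simp [braidedComul_one]
  | hsmul r x hx => simp [hx]
  | hadd x y hx hy => simp only [map_add, hx, hy, TensorProduct.tmul_add]
  | hmul g v x hv hx =>
    have key : ∀ t, algebraMapInv.toLinearMap.rTensor _ (primMul k G V v t) =
        (LinearMap.mulLeft k (ι k v)).lTensor _ (algebraMapInv.toLinearMap.rTensor _ t) := by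
      intro t
      induction t with
      | zero => simp
      | add a b ha hb => simp only [map_add, ha, hb]
      | tmul x y => simp [primMul_tmul hv, algebraMapInv_act, algebraMapInv_ι]
    rw [braidedComul_ι_mul, key, hx]
    simp

theorem braidedComul_counit (x : TensorAlgebra k V) :
    algebraMapInv.toLinearMap.lTensor _ (braidedComul k G V x) = x ⊗ₜ[k] (1 : k) := by
  induction x using induction_hom k G (V := V) with
  | h1 => simp [braidedComul_one]
  | hsmul r x hx => simp [hx, TensorProduct.smul_tmul']
  | hadd x y hx hy => simp only [map_add, hx, hy, TensorProduct.add_tmul]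
  | hmul g v x hv hx =>
    have key : ∀ t, algebraMapInv.toLinearMap.lTensor _ (primMul k G V v t) =
        (LinearMap.mulLeft k (ι k v)).rTensor _ (algebraMapInv.toLinearMap.lTensor _ t) := by
      intro t
      induction t with
      | zero => simp
      | add a b ha hb => simp only [map_add, ha, hb]
      | tmul x y => simp [primMul_tmul hv, algebraMapInv_ι]
    rw [braidedComul_ι_mul, key, hx]
    simp

variable (k G V) in
/-- The braided coalgebra structure of `T(V)`. It depends on `G`, so it is not an instance. -/
abbrev braidedCoalgebra : Coalgebra k (TensorAlgebra k V) where
  comul := braidedComul k G V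
  counit := algebraMapInv.toLinearMap
  coassoc := LinearMap.ext braidedComul_coassoc
  rTensor_counit_comp_comul := LinearMap.ext counit_braidedComul
  lTensor_counit_comp_comul := LinearMap.ext braidedComul_counit

theorem braidedBialgebra :
    letI := braidedCoalgebra k G V
    BraidedBialgebra k G (TensorAlgebra k V) := by
  let := braidedCoalgebra k G V
  exact
    { act_one := act_one
      act_mul := act_mul
      coact_one := coact_one
      coact_mul := coact_mul
      comul_act := braidedComul_act
      counit_act := algebraMapInv_act
      coact_comul := braidedComul_coact
      coact_counit := coact_algebraMapInv
      comul_one := braidedComul_one k G V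
      comul_mul := braidedComul_mul
      counit_one := map_one algebraMapInv
      counit_mul := map_mul algebraMapInv }

end TensorAlgebra
end TensorAlg


section Nichols
open GroupComodule YetterDrinfeld TensorAlgebra
variable (k G V : Type*) [Field k] [Group G] [AddCommGroup V] [Module k V] [YetterDrinfeld k G V]

/-- The two-sided ideals of `T(V)` that are homogeneous with all generators in degrees `≥ 2`,
are Yetter-Drinfeld submodules, and are coideals. -/
structure IsNicholsIdeal (J : Ideal (TensorAlgebra k V)) : Prop where
  isTwoSided : J.IsTwoSided
  homogeneous : J.restrictScalars k ≤
    ⨆ n ≥ 2, J.restrictScalars k ⊓ LinearMap.range (ι k : V →ₗ[k] TensorAlgebra k V) ^ n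
  act_mem : ∀ (g : G), ∀ x ∈ J, act (k := k) g x ∈ J
  coact_mem : ∀ x ∈ J, coact (k := k) (G := G) x ∈
    LinearMap.range ((J.restrictScalars k).subtype.lTensor (MonoidAlgebra k G))
  comul_mem : ∀ x ∈ J, braidedComul k G V x ∈
    LinearMap.range ((J.restrictScalars k).subtype.rTensor (TensorAlgebra k V)) ⊔
      LinearMap.range ((J.restrictScalars k).subtype.lTensor (TensorAlgebra k V))

/-- The defining ideal of the Nichols algebra: the sum of all ideals as in `IsNicholsIdeal`. -/
def nicholsIdeal : Ideal (TensorAlgebra k V) := sSup {J | IsNicholsIdeal k G V J}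

variable {k G V} in
theorem nicholsIdeal_induction 
    {P : ∀ x : TensorAlgebra k V, x ∈ nicholsIdeal k G V → Prop} (h0 : P 0 (zero_mem _))
    (hadd : ∀ x y hx hy, P x hx → P y hy → P (x + y) (add_mem hx hy))
    (h : ∀ J, IsNicholsIdeal k G V J → ∀ hle : J ≤ nicholsIdeal k G V, ∀ x (hx : x ∈ J),
      P x (hle hx))
    {x : TensorAlgebra k V} (hx : x ∈ nicholsIdeal k G V) : P x hx := by
  have hx' := hx
  rw [nicholsIdeal, sSup_eq_iSup'] at hx'
  suffices h' : ∃ hx, P x hx from h'.2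
  clear hx
  induction hx' using Submodule.iSup_induction' with
  | mem J x hx => exact ⟨_, h J.1 J.2 (le_sSup J.2) x hx⟩
  | zero => exact ⟨_, h0⟩
  | add x y _ _ hx hy => exact ⟨_, hadd x y _ _ hx.2 hy.2⟩

variable {k G V} in
theorem subtype_lTensor_range_mono {W : Type*} [AddCommGroup W] [Module k W]
    {J K : Submodule k V} (h : J ≤ K) :
    LinearMap.range (J.subtype.lTensor W) ≤ LinearMap.range (K.subtype.lTensor W) := by
  rw [← Submodule.subtype_comp_inclusion J K h, LinearMap.lTensor_comp]
  exact LinearMap.range_comp_le_range _ _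

variable {k G V} in
theorem subtype_rTensor_range_mono {W : Type*} [AddCommGroup W] [Module k W]
    {J K : Submodule k V} (h : J ≤ K) :
    LinearMap.range (J.subtype.rTensor W) ≤ LinearMap.range (K.subtype.rTensor W) := by
  rw [← Submodule.subtype_comp_inclusion J K h, LinearMap.rTensor_comp]
  exact LinearMap.range_comp_le_range _ _

theorem isNicholsIdeal_nicholsIdeal : IsNicholsIdeal k G V (nicholsIdeal k G V) where
  isTwoSided := ⟨fun {a} b ha => by
    induction ha using nicholsIdeal_induction with
    | h0 => simp
    | hadd x y _ _ hx hy => rw [add_mul]; exact add_mem hx hy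
    | h J hJ hle x hx =>
      have := hJ.isTwoSided
      exact hle (J.mul_mem_right b hx)⟩
  homogeneous := fun x hx => by
    have hx' : x ∈ nicholsIdeal k G V := hx
    clear hx
    induction hx' using nicholsIdeal_induction with
    | h0 => exact zero_mem _
    | hadd x y _ _ hx hy => exact add_mem hx hy
    | h J hJ hle x hx =>
      have h2 : (⨆ n ≥ 2, J.restrictScalars k ⊓
          LinearMap.range (ι k : V →ₗ[k] TensorAlgebra k V) ^ n) ≤
          ⨆ n ≥ 2, (nicholsIdeal k G V).restrictScalars k ⊓
            LinearMap.range (ι k : V →ₗ[k] TensorAlgebra k V) ^ n :=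
        iSup₂_mono fun n _ => inf_le_inf_right _ hle
      exact h2 (hJ.homogeneous hx)
  act_mem := fun g x hx => by
    induction hx using nicholsIdeal_induction with
    | h0 => simp
    | hadd x y _ _ hx hy => rw [map_add]; exact add_mem hx hy
    | h J hJ hle x hx => exact hle (hJ.act_mem g x hx)
  coact_mem := fun x hx => by
    induction hx using nicholsIdeal_induction with
    | h0 => rw [map_zero]; exact zero_mem _
    | hadd x y _ _ hx hy => rw [map_add]; exact add_mem hx hy
    | h J hJ hle x hx => 
      exact subtype_lTensor_range_mono (J := J.restrictScalars k)
        (K := (nicholsIdeal k G V).restrictScalars k) hle (hJ.coact_mem x hx)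
  comul_mem := fun x hx => by
    induction hx using nicholsIdeal_induction with
    | h0 => rw [map_zero]; exact zero_mem _
    | hadd x y _ _ hx hy => rw [map_add]; exact add_mem hx hy
    | h J hJ hle x hx =>
      have h1 := subtype_rTensor_range_mono (k := k) (W := TensorAlgebra k V)
        (J := J.restrictScalars k) (K := (nicholsIdeal k G V).restrictScalars k) hle
      have h2 := subtype_lTensor_range_mono (k := k) (W := TensorAlgebra k V)
        (J := J.restrictScalars k) (K := (nicholsIdeal k G V).restrictScalars k) hle
      exact sup_le_sup h1 h2 (hJ.comul_mem x hx)

instance : (nicholsIdeal k G V).IsTwoSided := (isNicholsIdeal_nicholsIdeal k G V).isTwoSided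

/-- The Nichols algebra `B(V) = T(V) / I(V)` of a Yetter-Drinfeld module `V` over `k[G]`. -/
def NicholsAlgebra : Type _ := TensorAlgebra k V ⧸ nicholsIdeal k G V

namespace NicholsAlgebra

instance : Ring (NicholsAlgebra k G V) :=
  inferInstanceAs (Ring (TensorAlgebra k V ⧸ nicholsIdeal k G V))

instance : Algebra k (NicholsAlgebra k G V) :=
  inferInstanceAs (Algebra k (TensorAlgebra k V ⧸ nicholsIdeal k G V))

/-- The projection `T(V) → B(V)`. -/
def mk : TensorAlgebra k V →ₐ[k] NicholsAlgebra k G V := Ideal.Quotient.mkₐ k (nicholsIdeal k G V)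

theorem mk_surjective : Function.Surjective (mk k G V) := Ideal.Quotient.mkₐ_surjective k _

variable {k G V} {W : Type*} [AddCommGroup W] [Module k W]

theorem mk_eq_zero {x : TensorAlgebra k V} : mk k G V x = 0 ↔ x ∈ nicholsIdeal k G V :=
  Ideal.Quotient.eq_zero_iff_mem

/-- Linear maps out of `B(V)` from linear maps out of `T(V)` vanishing on `I(V)`. -/
def lift (f : TensorAlgebra k V →ₗ[k] W) (hf : ∀ x ∈ nicholsIdeal k G V, f x = 0) :
    NicholsAlgebra k G V →ₗ[k] W :=
  Submodule.liftQ (LinearMap.ker (mk k G V).toLinearMap) f (fun x hx => hf x (mk_eq_zero.1 hx)) ∘ₗ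
    ((mk k G V).toLinearMap.quotKerEquivOfSurjective (mk_surjective k G V)).symm.toLinearMap

@[simp]
theorem lift_mk (f : TensorAlgebra k V →ₗ[k] W) (hf) (x) :
    lift (G := G) f hf (mk k G V x) = f x := by
  have : ((mk k G V).toLinearMap.quotKerEquivOfSurjective (mk_surjective k G V)).symm
      (mk k G V x) = Submodule.Quotient.mk x := by
    rw [LinearEquiv.symm_apply_eq]
    rfl
  simp only [lift, LinearMap.comp_apply, LinearEquiv.coe_coe, this]
  exact Submodule.liftQ_apply _ _ _

theorem mk_act_eq_zero (g : G) (x) (hx : x ∈ nicholsIdeal k G V) :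
    ((mk k G V).toLinearMap ∘ₗ act (k := k) g) x = 0 :=
  mk_eq_zero.2 ((isNicholsIdeal_nicholsIdeal k G V).act_mem g x hx)

theorem mk_subtype :
    (mk k G V).toLinearMap ∘ₗ ((nicholsIdeal k G V).restrictScalars k).subtype = 0 :=
  LinearMap.ext fun x => mk_eq_zero.2 x.2

theorem mk_coact_eq_zero (x) (hx : x ∈ nicholsIdeal k G V) :
    ((mk k G V).toLinearMap.lTensor _ ∘ₗ coact (k := k) (G := G)) x = 0 := by
  obtain ⟨y, hy⟩ := (isNicholsIdeal_nicholsIdeal k G V).coact_mem x hx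
  rw [LinearMap.comp_apply, ← hy, ← LinearMap.comp_apply, ← LinearMap.lTensor_comp, mk_subtype]
  simp

theorem mk_comul_eq_zero (x) (hx : x ∈ nicholsIdeal k G V) :
    (TensorProduct.map (mk k G V).toLinearMap (mk k G V).toLinearMap ∘ₗ braidedComul k G V) x =
      0 := by
  obtain ⟨y, ⟨y', rfl⟩, z, ⟨z', rfl⟩, hyz⟩ :=
    Submodule.mem_sup.1 ((isNicholsIdeal_nicholsIdeal k G V).comul_mem x hx)
  rw [LinearMap.comp_apply, ← hyz, map_add, LinearMap.rTensor, LinearMap.lTensor,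
    TensorProduct.map_map, TensorProduct.map_map, mk_subtype]
  simp

theorem algebraMapInv_eq_zero (x) (hx : x ∈ nicholsIdeal k G V) :
    algebraMapInv.toLinearMap x = (0 : k) := by
  have h : (nicholsIdeal k G V).restrictScalars k ≤ LinearMap.ker algebraMapInv.toLinearMap := by
    refine (isNicholsIdeal_nicholsIdeal k G V).homogeneous.trans (iSup₂_le fun n hn => ?_)
    refine inf_le_right.trans ?_
    obtain ⟨m, rfl⟩ : ∃ m, n = m + 1 := ⟨n - 1, by omega⟩
    rw [pow_succ, Submodule.mul_le]
    rintro a _ _ ⟨v, rfl⟩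
    simp [algebraMapInv_ι]
  exact h hx

theorem hom_ext {f f' : NicholsAlgebra k G V →ₗ[k] W} (h : ∀ x, f (mk k G V x) = f' (mk k G V x)) :
    f = f' :=
  LinearMap.ext fun y => by
    obtain ⟨x, rfl⟩ := mk_surjective k G V y
    exact h x

instance : GroupComodule k G (NicholsAlgebra k G V) where
  coact := lift _ mk_coact_eq_zero
  coassoc := hom_ext fun x => by
    induction x using hom_induction k G (V := TensorAlgebra k V) with
    | h0 => simp only [map_zero]
    | hadd x y hx hy => simp only [map_add, hx, hy]
    | h g x hx => rw [mem_degreePart] at hx; simp [hx]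
  counit := hom_ext fun x => by
    induction x using hom_induction k G (V := TensorAlgebra k V) with
    | h0 => simp only [map_zero]
    | hadd x y hx hy => simp only [map_add, hx, hy]
    | h g x hx => rw [mem_degreePart] at hx; simp [hx]

theorem coact_mk (x : TensorAlgebra k V) : coact (k := k) (G := G) (mk k G V x) =
    (mk k G V).toLinearMap.lTensor _ (coact (k := k) (G := G) x) := lift_mk _ _ _

theorem mk_mem {g : G} {x : TensorAlgebra k V} (hx : x ∈ degreePart k G (TensorAlgebra k V) g) :
    mk k G V x ∈ degreePart k G (NicholsAlgebra k G V) g := by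
  rw [mem_degreePart] at *
  simp [coact_mk, hx]

instance : YetterDrinfeld k G (NicholsAlgebra k G V) where
  act :=
    { toFun := fun g => lift _ (mk_act_eq_zero g)
      map_one' := hom_ext fun x => by simp
      map_mul' := fun g h => hom_ext fun x => by simp }
  compat := fun g y => by
    obtain ⟨x, rfl⟩ := mk_surjective k G V y
    induction x using hom_induction k G (V := TensorAlgebra k V) with
    | h0 => simp only [map_zero]
    | hadd x y hx hy => simp only [map_add, hx, hy]
    | h h x hx =>
      have h0 := act_mem (g := g) hx
      have h1 := mk_mem h0
      have h2 := mk_mem hx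
      rw [mem_degreePart] at h1 h2
      simpa [h2] using h1

theorem act_mk (g : G) (x : TensorAlgebra k V) :
    act (k := k) g (mk k G V x) = mk k G V (act (k := k) g x) :=
  lift_mk _ (mk_act_eq_zero g) x

theorem assoc_map_mk (t : (TensorAlgebra k V ⊗[k] TensorAlgebra k V) ⊗[k] TensorAlgebra k V) :
    TensorProduct.assoc k _ _ _ (TensorProduct.map (TensorProduct.map (mk k G V).toLinearMap
      (mk k G V).toLinearMap) (mk k G V).toLinearMap t) =
    TensorProduct.map (mk k G V).toLinearMap (TensorProduct.map (mk k G V).toLinearMap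
      (mk k G V).toLinearMap) (TensorProduct.assoc k _ _ _ t) :=
  LinearMap.congr_fun (TensorProduct.map_map_comp_assoc_eq _ _ _).symm t

variable (k G V) in
/-- The comultiplication of `B(V)`, induced by the one of `T(V)`. -/
def comulMap : NicholsAlgebra k G V →ₗ[k] NicholsAlgebra k G V ⊗[k] NicholsAlgebra k G V :=
  lift _ mk_comul_eq_zero

theorem comulMap_mk (x : TensorAlgebra k V) : comulMap k G V (mk k G V x) =
    TensorProduct.map (mk k G V).toLinearMap (mk k G V).toLinearMap (braidedComul k G V x) :=
  lift_mk _ _ _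

variable (k G V) in
/-- The counit of `B(V)`, induced by the one of `T(V)`. -/
def counitMap : NicholsAlgebra k G V →ₗ[k] k := lift _ algebraMapInv_eq_zero

theorem counitMap_mk (x : TensorAlgebra k V) :
    counitMap k G V (mk k G V x) = algebraMapInv x := lift_mk _ _ _

instance : Coalgebra k (NicholsAlgebra k G V) where
  comul := comulMap k G V
  counit := counitMap k G V
  coassoc := hom_ext fun x => by
    have hL : ∀ t, (comulMap k G V).rTensor _ (TensorProduct.map (mk k G V).toLinearMap
        (mk k G V).toLinearMap t) = TensorProduct.map (TensorProduct.map (mk k G V).toLinearMap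
        (mk k G V).toLinearMap) (mk k G V).toLinearMap ((braidedComul k G V).rTensor _ t) := by
      intro t
      induction t with
      | zero => simp only [map_zero]
      | add a b ha hb => simp only [map_add, ha, hb]
      | tmul a b => simp [comulMap_mk]
    have hR : ∀ t, (comulMap k G V).lTensor _ (TensorProduct.map (mk k G V).toLinearMap
        (mk k G V).toLinearMap t) = TensorProduct.map (mk k G V).toLinearMap
        (TensorProduct.map (mk k G V).toLinearMap (mk k G V).toLinearMap)
        ((braidedComul k G V).lTensor _ t) := by
      intro t
      induction t with
      | zero => simp only [map_zero]
      | add a b ha hb => simp only [map_add, ha, hb]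
      | tmul a b => simp [comulMap_mk]
    simp only [LinearMap.comp_apply, LinearEquiv.coe_coe, comulMap_mk, hL, hR, assoc_map_mk,
      braidedComul_coassoc]
  rTensor_counit_comp_comul := hom_ext fun x => by
    have h : ∀ t, (counitMap k G V).rTensor _ (TensorProduct.map (mk k G V).toLinearMap
        (mk k G V).toLinearMap t) =
        (mk k G V).toLinearMap.lTensor k (algebraMapInv.toLinearMap.rTensor _ t) := by
      intro t
      induction t with
      | zero => simp only [map_zero]
      | add a b ha hb => simp only [map_add, ha, hb]
      | tmul a b => simp [counitMap_mk]
    simp [comulMap_mk, h, counit_braidedComul]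
  lTensor_counit_comp_comul := hom_ext fun x => by
    have h : ∀ t, (counitMap k G V).lTensor _ (TensorProduct.map (mk k G V).toLinearMap
        (mk k G V).toLinearMap t) =
        (mk k G V).toLinearMap.rTensor k (algebraMapInv.toLinearMap.lTensor _ t) := by
      intro t
      induction t with
      | zero => simp only [map_zero]
      | add a b ha hb => simp only [map_add, ha, hb]
      | tmul a b => simp [counitMap_mk]
    simp [comulMap_mk, h, braidedComul_counit]

theorem comul_mk (x : TensorAlgebra k V) : Coalgebra.comul (R := k) (mk k G V x) =
    TensorProduct.map (mk k G V).toLinearMap (mk k G V).toLinearMap (braidedComul k G V x) :=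
  comulMap_mk x

theorem counit_mk (x : TensorAlgebra k V) :
    Coalgebra.counit (R := k) (mk k G V x) = algebraMapInv x := counitMap_mk x

theorem coactTensor_mk (t : TensorAlgebra k V ⊗[k] TensorAlgebra k V) :
    coactTensor k G _ _ (TensorProduct.map (mk k G V).toLinearMap (mk k G V).toLinearMap t) =
      (TensorProduct.map (mk k G V).toLinearMap (mk k G V).toLinearMap).lTensor _
        (coactTensor k G _ _ t) := by
  induction t with
  | zero => simp only [map_zero]
  | add a b ha hb => simp only [map_add, ha, hb]
  | tmul a b =>
    induction a using hom_induction k G (V := TensorAlgebra k V) with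
    | h0 => simp only [map_zero, TensorProduct.zero_tmul]
    | hadd x y hx hy => simp only [map_add, TensorProduct.add_tmul, hx, hy]
    | h g a ha =>
      induction b using hom_induction k G (V := TensorAlgebra k V) with
      | h0 => simp only [map_zero, TensorProduct.tmul_zero]
      | hadd x y hx hy => simp only [map_add, TensorProduct.tmul_add, hx, hy]
      | h h b hb =>
        rw [coactTensor_tmul ha hb, TensorProduct.map_tmul]
        exact coactTensor_tmul (mk_mem ha) (mk_mem hb)

theorem braidedMul_mk (s t : TensorAlgebra k V ⊗[k] TensorAlgebra k V) :
    braidedMul k G _ (TensorProduct.map (mk k G V).toLinearMap (mk k G V).toLinearMap s ⊗ₜ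
      TensorProduct.map (mk k G V).toLinearMap (mk k G V).toLinearMap t) =
    TensorProduct.map (mk k G V).toLinearMap (mk k G V).toLinearMap
      (braidedMul k G _ (s ⊗ₜ t)) := by
  induction s with
  | zero => simp only [map_zero, TensorProduct.zero_tmul]
  | add a b ha hb => simp only [map_add, TensorProduct.add_tmul, ha, hb]
  | tmul a b =>
    induction t with
    | zero => simp only [map_zero, TensorProduct.tmul_zero]
    | add a b ha hb => simp only [map_add, TensorProduct.tmul_add, ha, hb]
    | tmul c d =>
      induction b using hom_induction k G (V := TensorAlgebra k V) with
      | h0 => simp only [map_zero, TensorProduct.tmul_zero, TensorProduct.zero_tmul]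
      | hadd x y hx hy => simp only [map_add, TensorProduct.tmul_add, TensorProduct.add_tmul, hx, hy]
      | h g b hb =>
        have hb' := mk_mem hb
        rw [braidedMul_tmul hb]
        simp only [TensorProduct.map_tmul, AlgHom.toLinearMap_apply]
        rw [braidedMul_tmul hb', act_mk, map_mul, map_mul]

instance : BraidedBialgebra k G (NicholsAlgebra k G V) where
  act_one := fun g => by rw [← map_one (mk k G V), act_mk, TensorAlgebra.act_one]
  act_mul := fun g a b => by
    obtain ⟨x, rfl⟩ := mk_surjective k G V a
    obtain ⟨y, rfl⟩ := mk_surjective k G V b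
    rw [← map_mul, act_mk, TensorAlgebra.act_mul, map_mul, act_mk, act_mk]
  coact_one := by
    rw [← map_one (mk k G V), coact_mk, TensorAlgebra.coact_one, Algebra.TensorProduct.one_def]
    simp [Algebra.TensorProduct.one_def]
  coact_mul := fun a b => by
    obtain ⟨x, rfl⟩ := mk_surjective k G V a
    obtain ⟨y, rfl⟩ := mk_surjective k G V b
    rw [← map_mul, coact_mk, TensorAlgebra.coact_mul, coact_mk, coact_mk]
    exact map_mul (Algebra.TensorProduct.map (AlgHom.id k (MonoidAlgebra k G)) (mk k G V)) _ _
  comul_act := fun g a => by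
    obtain ⟨x, rfl⟩ := mk_surjective k G V a
    rw [act_mk, comul_mk, comul_mk, braidedComul_act, TensorProduct.map_map, TensorProduct.map_map]
    congr 2 <;> exact LinearMap.ext fun y => (act_mk g y).symm
  counit_act := fun g a => by
    obtain ⟨x, rfl⟩ := mk_surjective k G V a
    rw [act_mk, counit_mk, counit_mk, algebraMapInv_act]
  coact_comul := fun a => by
    obtain ⟨x, rfl⟩ := mk_surjective k G V a
    rw [comul_mk, coactTensor_mk, braidedComul_coact, coact_mk,
      ← LinearMap.lTensor_comp_apply, ← LinearMap.lTensor_comp_apply]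
    have : TensorProduct.map (mk k G V).toLinearMap (mk k G V).toLinearMap ∘ₗ braidedComul k G V =
        Coalgebra.comul ∘ₗ (mk k G V).toLinearMap := LinearMap.ext fun y => (comul_mk y).symm
    rw [this]
  coact_counit := fun a => by
    obtain ⟨x, rfl⟩ := mk_surjective k G V a
    have h : ∀ t : MonoidAlgebra k G ⊗[k] TensorAlgebra k V, (counitMap k G V).lTensor _
        ((mk k G V).toLinearMap.lTensor _ t) = algebraMapInv.toLinearMap.lTensor _ t := by
      intro t
      induction t with
      | zero => simp only [map_zero]
      | add a b ha hb => simp only [map_add, ha, hb]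
      | tmul a b => simp [counitMap_mk]
    rw [counit_mk, coact_mk, ← coact_algebraMapInv (G := G), ← h]
    rfl
  comul_one := by
    rw [← map_one (mk k G V), comul_mk, braidedComul_one]
    rfl
  comul_mul := fun a b => by
    obtain ⟨x, rfl⟩ := mk_surjective k G V a
    obtain ⟨y, rfl⟩ := mk_surjective k G V b
    rw [← map_mul, comul_mk, comul_mk, comul_mk, braidedMul_mk, braidedComul_mul]
  counit_one := by rw [← map_one (mk k G V), counit_mk, map_one]
  counit_mul := fun a b => by
    obtain ⟨x, rfl⟩ := mk_surjective k G V a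
    obtain ⟨y, rfl⟩ := mk_surjective k G V b
    rw [← map_mul, counit_mk, counit_mk, counit_mk, map_mul]

end NicholsAlgebra

end Nichols


section Degree
open GroupComodule YetterDrinfeld TensorAlgebra
variable {k G V : Type*} [Field k] [Group G] [AddCommGroup V] [Module k V] [YetterDrinfeld k G V]

/-- The augmentation ideal of `B(V)` consists of all parts of degree `≥ 1` of its grading. -/
theorem NicholsAlgebra.ker_counit :
    LinearMap.ker (Coalgebra.counit (R := k) (A := NicholsAlgebra k G V)) =
      ⨆ n ≥ 1, (LinearMap.range (ι k : V →ₗ[k] TensorAlgebra k V) ^ n).map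
        (NicholsAlgebra.mk k G V).toLinearMap := by
  apply le_antisymm
  · have key : ∀ x : TensorAlgebra k V, mk k G V x - algebraMap k _ (algebraMapInv x) ∈
        ⨆ n ≥ 1, (LinearMap.range (ι k : V →ₗ[k] TensorAlgebra k V) ^ n).map
          (NicholsAlgebra.mk k G V).toLinearMap := by
      intro x
      induction x using induction_hom k G (V := V) with
      | h1 => simp
      | hsmul r x hx =>
        have := Submodule.smul_mem _ r hx
        rwa [smul_sub, ← map_smul, Algebra.smul_def r (algebraMap k _ _), ← map_mul,
          ← smul_eq_mul, ← map_smul] at this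
      | hadd x y hx hy =>
        have := add_mem hx hy
        rwa [sub_add_sub_comm, ← map_add, ← map_add, ← map_add] at this
      | hmul g v x hv hx =>
        rw [map_mul algebraMapInv, algebraMapInv_ι, zero_mul, map_zero, sub_zero]
        clear hx
        induction x using DirectSum.Decomposition.inductionOn
          (fun n => LinearMap.range (ι k : V →ₗ[k] TensorAlgebra k V) ^ n) with
        | zero => simp
        | @homogeneous n m =>
          refine Submodule.mem_iSup_of_mem (n + 1) (Submodule.mem_iSup_of_mem (by omega) ?_)
          refine Submodule.mem_map_of_mem ?_
          rw [pow_succ']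
          exact Submodule.mul_mem_mul ⟨v, rfl⟩ m.2
        | add a b ha hb => rw [mul_add, map_add]; exact add_mem ha hb
    intro y hy
    obtain ⟨x, rfl⟩ := NicholsAlgebra.mk_surjective k G V y
    rw [LinearMap.mem_ker, NicholsAlgebra.counit_mk] at hy
    simpa [hy] using key x
  · refine iSup₂_le fun n hn => ?_
    obtain ⟨m, rfl⟩ : ∃ m, n = m + 1 := ⟨n - 1, by omega⟩
    rw [Submodule.map_le_iff_le_comap, pow_succ, Submodule.mul_le]
    rintro a _ _ ⟨v, rfl⟩
    rw [Submodule.mem_comap, AlgHom.toLinearMap_apply, LinearMap.mem_ker,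
      NicholsAlgebra.counit_mk, map_mul, algebraMapInv_ι, mul_zero]
end Degree


set_option linter.unusedSectionVars false
section Boson
open GroupComodule YetterDrinfeld

/-- The bosonization `R # k[G]` of a bialgebra `R` in Yetter-Drinfeld modules over `k[G]`:
the vector space `R ⊗ k[G]` with the smash product algebra and smash coproduct coalgebra
structures. The element `r # x` is `Bosonization.tmul r x`. -/
def Bosonization (k G R : Type*) [Field k] [Group G] [Ring R] [Algebra k R] : Type _ :=
  R ⊗[k] MonoidAlgebra k G

namespace Bosonization

section
variable (k G R : Type*) [Field k] [Group G] [Ring R] [Algebra k R]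

instance : AddCommGroup (Bosonization k G R) :=
  inferInstanceAs (AddCommGroup (R ⊗[k] MonoidAlgebra k G))

instance : Module k (Bosonization k G R) :=
  inferInstanceAs (Module k (R ⊗[k] MonoidAlgebra k G))

variable [YetterDrinfeld k G R]

/-- The commutation `g ⊗ r ↦ (g · r) ⊗ g`. -/
def commute : MonoidAlgebra k G ⊗[k] R →ₗ[k] R ⊗[k] MonoidAlgebra k G :=
  TensorProduct.map
      (TensorProduct.lift (act (k := k) (G := G) (V := R)).asAlgebraHom.toLinearMap) LinearMap.id ∘ₗ
    (TensorProduct.rightComm k (MonoidAlgebra k G) (MonoidAlgebra k G) R).toLinearMap ∘ₗ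
    (Coalgebra.comul (R := k) (A := MonoidAlgebra k G)).rTensor R

/-- The smash product multiplication `(r # g)(r' # g') = r (g · r') # g g'`. -/
def mulMap : (R ⊗[k] MonoidAlgebra k G) ⊗[k] (R ⊗[k] MonoidAlgebra k G) →ₗ[k]
    R ⊗[k] MonoidAlgebra k G :=
  TensorProduct.map (LinearMap.mul' k R) (LinearMap.mul' k (MonoidAlgebra k G)) ∘ₗ
    (TensorProduct.assoc k R R _).symm.toLinearMap ∘ₗ
    ((TensorProduct.assoc k R _ _).toLinearMap ∘ₗ (commute k G R).rTensor _ ∘ₗ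
      (TensorProduct.assoc k _ R _).symm.toLinearMap).lTensor R ∘ₗ
    (TensorProduct.assoc k R _ _).toLinearMap

/-- The smash coproduct `Δ(r # g) = ∑ r₁ # (r₂)₍₋₁₎ g ⊗ (r₂)₍₀₎ # g`, for `Δ(r) = ∑ r₁ ⊗ r₂`. -/
def comulMap [Coalgebra k R] : R ⊗[k] MonoidAlgebra k G →ₗ[k]
    (R ⊗[k] MonoidAlgebra k G) ⊗[k] (R ⊗[k] MonoidAlgebra k G) :=
  ((LinearMap.mul' k (MonoidAlgebra k G)).lTensor R ∘ₗ
      (TensorProduct.assoc k R _ _).toLinearMap).rTensor _ ∘ₗ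
    (TensorProduct.tensorTensorTensorComm k _ _ _ _).toLinearMap ∘ₗ
    TensorProduct.map
      ((TensorProduct.assoc k R _ R).symm.toLinearMap ∘ₗ
        (coact (k := k) (G := G) (V := R)).lTensor R ∘ₗ Coalgebra.comul)
      (Coalgebra.comul (R := k) (A := MonoidAlgebra k G))

/-- The counit `ε(r # g) = ε(r) ε(g)`. -/
def counitMap [Coalgebra k R] : R ⊗[k] MonoidAlgebra k G →ₗ[k] k :=
  LinearMap.mul' k k ∘ₗ TensorProduct.map (Coalgebra.counit (R := k) (A := R))
    (Coalgebra.counit (R := k) (A := MonoidAlgebra k G))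

end

section
variable {k G R : Type*} [Field k] [Group G] [Ring R] [Algebra k R]

/-- The element `r # g`. -/
def tmul (r : R) (g : G) : R ⊗[k] MonoidAlgebra k G := r ⊗ₜ MonoidAlgebra.single g (1 : k)

theorem induction {P : R ⊗[k] MonoidAlgebra k G → Prop} (h0 : P 0)
    (hadd : ∀ x y, P x → P y → P (x + y)) (h : ∀ (r : R) (g : G), P (tmul r g))
    (x : R ⊗[k] MonoidAlgebra k G) : P x := by
  induction x with
  | zero => exact h0
  | add x y hx hy => exact hadd x y hx hy
  | tmul r a =>
    induction a using MonoidAlgebra.induction_linear with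
    | zero => simpa using h0
    | add x y hx hy => rw [TensorProduct.tmul_add]; exact hadd _ _ hx hy
    | single g c =>
      have := h (c • r) g
      rw [tmul, TensorProduct.smul_tmul, MonoidAlgebra.smul_single, smul_eq_mul, mul_one] at this
      exact this

variable [YetterDrinfeld k G R]

theorem mulMap_tmul (r r' : R) (g g' : G) :
    mulMap k G R (tmul r g ⊗ₜ tmul r' g') = tmul (r * act (k := k) g r') (g * g') := by
  simp [mulMap, tmul, commute]

variable (k G R) in
/-- The map `a ⊗ b ↦ a # b₍₋₁₎ g ⊗ b₍₀₎ # g`. -/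
def spread (g : G) : R ⊗[k] R →ₗ[k] (R ⊗[k] MonoidAlgebra k G) ⊗[k] (R ⊗[k] MonoidAlgebra k G) :=
  ((LinearMap.mul' k (MonoidAlgebra k G)).lTensor R ∘ₗ
      (TensorProduct.assoc k R _ _).toLinearMap).rTensor _ ∘ₗ
    (TensorProduct.tensorTensorTensorComm k _ _ _ _).toLinearMap ∘ₗ
    (TensorProduct.mk k _ _).flip
      (MonoidAlgebra.single g (1 : k) ⊗ₜ MonoidAlgebra.single g (1 : k)) ∘ₗ
    (TensorProduct.assoc k R _ R).symm.toLinearMap ∘ₗ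
        (coact (k := k) (G := G) (V := R)).lTensor R

theorem spread_tmul {h : G} {b : R} (hb : b ∈ degreePart k G R h) (g : G) (a : R) :
    spread k G R g (a ⊗ₜ b) = tmul a (h * g) ⊗ₜ tmul b g := by
  rw [mem_degreePart] at hb
  simp [spread, tmul, hb]

theorem counitMap_tmul [Coalgebra k R] (r : R) (g : G) :
    counitMap k G R (tmul r g) = Coalgebra.counit (R := k) r := by
  simp [counitMap, tmul]

theorem comulMap_tmul [Coalgebra k R] (r : R) (g : G) :
    comulMap k G R (tmul r g) = spread k G R g (Coalgebra.comul r) := by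
  simp [comulMap, spread, tmul]

end

section
variable {k G R : Type*} [Field k] [Group G] [Ring R] [Algebra k R] [YetterDrinfeld k G R]
  [Coalgebra k R] [BraidedBialgebra k G R]

variable (k G R) in
/-- The map `u ⊗ w ↦ (a # u g) ⊗ spread w`. -/
def spread₃ (g : G) (a : R) : MonoidAlgebra k G ⊗[k] (R ⊗[k] R) →ₗ[k]
    (R ⊗[k] MonoidAlgebra k G) ⊗[k]
      ((R ⊗[k] MonoidAlgebra k G) ⊗[k] (R ⊗[k] MonoidAlgebra k G)) :=
  TensorProduct.map (TensorProduct.mk k R _ a ∘ₗ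
    LinearMap.mulRight k (MonoidAlgebra.single g (1 : k))) (spread k G R g)

theorem comulMap_coassoc (x : R ⊗[k] MonoidAlgebra k G) :
    TensorProduct.assoc k _ _ _ ((comulMap k G R).rTensor _ (comulMap k G R x)) =
      (comulMap k G R).lTensor _ (comulMap k G R x) := by
  induction x using induction with
  | h0 => simp only [map_zero]
  | hadd x y hx hy => simp only [map_add, hx, hy]
  | h r g =>
    let F : R ⊗[k] (R ⊗[k] R) →ₗ[k] (R ⊗[k] MonoidAlgebra k G) ⊗[k]
        ((R ⊗[k] MonoidAlgebra k G) ⊗[k] (R ⊗[k] MonoidAlgebra k G)) :=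
      TensorProduct.lift (LinearMap.mk₂ k (fun a w => spread₃ k G R g a (coactTensor k G R R w))
        (fun a b w => by
          rw [spread₃, map_add, LinearMap.add_comp, TensorProduct.map_add_left]; rfl)
        (fun c a w => by
          rw [spread₃, map_smul, LinearMap.smul_comp, TensorProduct.map_smul_left]; rfl)
        (fun a w w' => by simp only [map_add])
        (fun c a w => by simp only [map_smul]))
    have hF : ∀ a w, F (a ⊗ₜ w) = spread₃ k G R g a (coactTensor k G R R w) := fun a w => rfl
    have hL : ∀ t, TensorProduct.assoc k _ _ _ ((comulMap k G R).rTensor _ (spread k G R g t)) =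
        F (TensorProduct.assoc k _ _ _ (Coalgebra.comul.rTensor _ t)) := by
      intro t
      induction t with
      | zero => simp only [map_zero]
      | add a b ha hb => simp only [map_add, ha, hb]
      | tmul a b =>
        induction b using hom_induction k G (V := R) with
        | h0 => simp only [map_zero, TensorProduct.tmul_zero]
        | hadd x y hx hy => simp only [map_add, TensorProduct.tmul_add, hx, hy]
        | h s b hb =>
          rw [spread_tmul hb, LinearMap.rTensor_tmul, LinearMap.rTensor_tmul, comulMap_tmul]
          generalize (Coalgebra.comul a : R ⊗[k] R) = t
          induction t with
          | zero => simp only [map_zero, TensorProduct.zero_tmul]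
          | add a b ha hb => simp only [map_add, TensorProduct.add_tmul, ha, hb]
          | tmul c d =>
            induction d using hom_induction k G (V := R) with
            | h0 => simp only [map_zero, TensorProduct.tmul_zero, TensorProduct.zero_tmul]
            | hadd x y hx hy =>
              simp only [map_add, TensorProduct.tmul_add, TensorProduct.add_tmul, hx, hy]
            | h u d hd =>
              rw [spread_tmul hd, TensorProduct.assoc_tmul, TensorProduct.assoc_tmul, hF,
                coactTensor_tmul hd hb, spread₃, TensorProduct.map_tmul, spread_tmul hb]
              simp [tmul, mul_assoc]
    have hR : ∀ t, (comulMap k G R).lTensor _ (spread k G R g t) =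
        F (Coalgebra.comul.lTensor _ t) := by
      intro t
      induction t with
      | zero => simp only [map_zero]
      | add a b ha hb => simp only [map_add, ha, hb]
      | tmul a b =>
        induction b using hom_induction k G (V := R) with
        | h0 => simp only [map_zero, TensorProduct.tmul_zero]
        | hadd x y hx hy => simp only [map_add, TensorProduct.tmul_add, hx, hy]
        | h s b hb =>
          rw [spread_tmul hb, LinearMap.lTensor_tmul, LinearMap.lTensor_tmul, comulMap_tmul, hF,
            BraidedBialgebra.coact_comul, mem_degreePart.1 hb]
          simp [spread₃, tmul]
    rw [comulMap_tmul, hL, hR, Coalgebra.coassoc_apply]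

theorem rTensor_counitMap (x : R ⊗[k] MonoidAlgebra k G) :
    (counitMap k G R).rTensor _ (comulMap k G R x) = (1 : k) ⊗ₜ[k] x := by
  induction x using induction with
  | h0 => simp only [map_zero, TensorProduct.tmul_zero]
  | hadd x y hx hy => simp only [map_add, hx, hy, TensorProduct.tmul_add]
  | h r g =>
    have h : ∀ t, (counitMap k G R).rTensor _ (spread k G R g t) =
        ((TensorProduct.mk k R _).flip (MonoidAlgebra.single g (1 : k))).lTensor k
          (Coalgebra.counit.rTensor _ t) := by
      intro t
      induction t with
      | zero => simp only [map_zero]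
      | add a b ha hb => simp only [map_add, ha, hb]
      | tmul a b =>
        induction b using hom_induction k G (V := R) with
        | h0 => simp only [map_zero, TensorProduct.tmul_zero]
        | hadd x y hx hy => simp only [map_add, TensorProduct.tmul_add, hx, hy]
        | h s b hb =>
          rw [spread_tmul hb, LinearMap.rTensor_tmul, counitMap_tmul]
          rfl
    rw [comulMap_tmul, h, Coalgebra.rTensor_counit_comul]
    rfl

theorem lTensor_counitMap (x : R ⊗[k] MonoidAlgebra k G) :
    (counitMap k G R).lTensor _ (comulMap k G R x) = x ⊗ₜ[k] (1 : k) := by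
  induction x using induction with
  | h0 => simp only [map_zero, TensorProduct.zero_tmul]
  | hadd x y hx hy => simp only [map_add, hx, hy, TensorProduct.add_tmul]
  | h r g =>
    have h : ∀ t, (counitMap k G R).lTensor _ (spread k G R g t) =
        ((TensorProduct.mk k R _).flip (MonoidAlgebra.single g (1 : k))).rTensor k
          (Coalgebra.counit.lTensor _ t) := by
      intro t
      induction t with
      | zero => simp only [map_zero]
      | add a b ha hb => simp only [map_add, ha, hb]
      | tmul a b =>
        induction b using hom_induction k G (V := R) with
        | h0 => simp only [map_zero, TensorProduct.tmul_zero]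
        | hadd x y hx hy => simp only [map_add, TensorProduct.tmul_add, hx, hy]
        | h s b hb =>
          rw [spread_tmul hb, LinearMap.lTensor_tmul, LinearMap.lTensor_tmul,
            LinearMap.rTensor_tmul, counitMap_tmul, LinearMap.flip_apply, TensorProduct.mk_apply]
          have h1 := BraidedBialgebra.coact_counit (k := k) (G := G) b
          rw [mem_degreePart.1 hb, LinearMap.lTensor_tmul, TensorProduct.rid_tmul] at h1
          by_cases hs : s = 1
          · rw [hs, one_mul]; rfl
          · have h2 : Coalgebra.counit (R := k) b = 0 := by
              have h3 := congrArg (fun z : MonoidAlgebra k G => z.coeff 1) h1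
              simpa [MonoidAlgebra.one_def, Finsupp.single_apply, hs] using h3.symm
            rw [h2, TensorProduct.tmul_zero, TensorProduct.tmul_zero]
    rw [comulMap_tmul, h, Coalgebra.lTensor_counit_comul]
    rfl

instance : Coalgebra k (Bosonization k G R) where
  comul := comulMap k G R
  counit := counitMap k G R
  coassoc := LinearMap.ext comulMap_coassoc
  rTensor_counit_comp_comul := LinearMap.ext rTensor_counitMap
  lTensor_counit_comp_comul := LinearMap.ext lTensor_counitMap

theorem mulMap_assoc (x y z : R ⊗[k] MonoidAlgebra k G) :
    mulMap k G R (mulMap k G R (x ⊗ₜ y) ⊗ₜ z) = mulMap k G R (x ⊗ₜ mulMap k G R (y ⊗ₜ z)) := by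
  induction x using induction with
  | h0 => simp only [map_zero, TensorProduct.zero_tmul]
  | hadd x x' hx hx' => simp only [map_add, hx, hx', TensorProduct.add_tmul]
  | h r g =>
    induction y using induction with
    | h0 => simp only [map_zero, TensorProduct.zero_tmul, TensorProduct.tmul_zero]
    | hadd x x' hx hx' =>
      simp only [map_add, hx, hx', TensorProduct.add_tmul, TensorProduct.tmul_add]
    | h r' g' =>
      induction z using induction with
      | h0 => simp only [map_zero, TensorProduct.tmul_zero]
      | hadd x x' hx hx' => simp only [map_add, hx, hx', TensorProduct.tmul_add]
      | h r'' g'' =>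
        simp only [mulMap_tmul, BraidedBialgebra.act_mul, map_mul, Module.End.mul_apply, mul_assoc]

theorem mulMap_one_left (x : R ⊗[k] MonoidAlgebra k G) : mulMap k G R (tmul 1 1 ⊗ₜ x) = x := by
  induction x using induction with
  | h0 => simp only [map_zero, TensorProduct.tmul_zero]
  | hadd x x' hx hx' => simp only [map_add, hx, hx', TensorProduct.tmul_add]
  | h r g => simp [mulMap_tmul]

theorem mulMap_one_right (x : R ⊗[k] MonoidAlgebra k G) : mulMap k G R (x ⊗ₜ tmul 1 1) = x := by
  induction x using induction with
  | h0 => simp only [map_zero, TensorProduct.zero_tmul]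
  | hadd x x' hx hx' => simp only [map_add, hx, hx', TensorProduct.add_tmul]
  | h r g => simp [mulMap_tmul, BraidedBialgebra.act_one]

theorem mulMap_zero_left (x : R ⊗[k] MonoidAlgebra k G) : mulMap k G R (0 ⊗ₜ x) = 0 := by
  rw [TensorProduct.zero_tmul, map_zero]

theorem mulMap_zero_right (x : R ⊗[k] MonoidAlgebra k G) : mulMap k G R (x ⊗ₜ 0) = 0 := by
  rw [TensorProduct.tmul_zero, map_zero]

theorem mulMap_add_left (x y z : R ⊗[k] MonoidAlgebra k G) :
    mulMap k G R ((x + y) ⊗ₜ z) = mulMap k G R (x ⊗ₜ z) + mulMap k G R (y ⊗ₜ z) := by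
  rw [TensorProduct.add_tmul, map_add]

theorem mulMap_add_right (x y z : R ⊗[k] MonoidAlgebra k G) :
    mulMap k G R (x ⊗ₜ (y + z)) = mulMap k G R (x ⊗ₜ y) + mulMap k G R (x ⊗ₜ z) := by
  rw [TensorProduct.tmul_add, map_add]

theorem mulMap_smul_left (c : k) (x y : R ⊗[k] MonoidAlgebra k G) :
    mulMap k G R ((c • x) ⊗ₜ y) = c • mulMap k G R (x ⊗ₜ y) := by
  rw [← TensorProduct.smul_tmul', map_smul]

theorem mulMap_smul_right (c : k) (x y : R ⊗[k] MonoidAlgebra k G) :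
    mulMap k G R (x ⊗ₜ (c • y)) = c • mulMap k G R (x ⊗ₜ y) := by
  rw [TensorProduct.tmul_smul, map_smul]

instance : Ring (Bosonization k G R) where
  __ := (inferInstance : AddCommGroup (Bosonization k G R))
  mul := fun x y => mulMap k G R (x ⊗ₜ y)
  one := tmul 1 1
  mul_assoc := mulMap_assoc
  one_mul := mulMap_one_left
  mul_one := mulMap_one_right
  zero_mul := fun x => mulMap_zero_left x
  mul_zero := fun x => mulMap_zero_right x
  left_distrib := fun x y z => mulMap_add_right x y z
  right_distrib := fun x y z => mulMap_add_left x y z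

instance : Algebra k (Bosonization k G R) :=
  Algebra.ofModule (fun c x y => mulMap_smul_left c x y) (fun c x y => mulMap_smul_right c x y)

theorem counit_one : Coalgebra.counit (R := k) (1 : Bosonization k G R) = 1 := by
  change counitMap k G R (tmul 1 1) = 1
  rw [counitMap_tmul, BraidedBialgebra.counit_one (G := G)]

theorem comul_one :
    Coalgebra.comul (R := k) (1 : Bosonization k G R) = 1 ⊗ₜ 1 := by
  change comulMap k G R (tmul 1 1) = tmul 1 1 ⊗ₜ tmul 1 1
  have h : (1 : R) ∈ degreePart k G R 1 := by
    rw [mem_degreePart, BraidedBialgebra.coact_one]; rfl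
  rw [comulMap_tmul, BraidedBialgebra.comul_one (G := G), spread_tmul h, one_mul]

end
end Bosonization
end Boson


set_option linter.unusedSectionVars false
section CobarSection
open GroupComodule YetterDrinfeld TensorAlgebra

/-- The element `1` of the coalgebra `C` is a coaugmentation, i.e. it is grouplike. -/
class IsCoaugmented (k C : Type*) [Field k] [AddCommGroup C] [Module k C] [Coalgebra k C] [One C] :
    Prop where
  counit_one : Coalgebra.counit (R := k) (1 : C) = 1
  comul_one : Coalgebra.comul (R := k) (1 : C) = 1 ⊗ₜ 1

section
variable (k C : Type*) [Field k] [AddCommGroup C] [Module k C] [Coalgebra k C] [One C]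

/-- The augmentation ideal `C⁺ = ker ε`. -/
abbrev augIdeal : Submodule k C := LinearMap.ker (Coalgebra.counit (R := k) (A := C))

variable [IsCoaugmented k C]

/-- The projection `C → C⁺`, `x ↦ x - ε(x) 1`. -/
def augProj : C →ₗ[k] augIdeal k C :=
  (LinearMap.id - LinearMap.toSpanSingleton k C 1 ∘ₗ Coalgebra.counit).codRestrict _ fun x => by
    simp [IsCoaugmented.counit_one]

/-- The reduced comultiplication `C⁺ → C⁺ ⊗ C⁺`, `x ↦ Δ(x) - x ⊗ 1 - 1 ⊗ x`, see
`subtype_reducedComul`. -/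
def reducedComul : augIdeal k C →ₗ[k] augIdeal k C ⊗[k] augIdeal k C :=
  TensorProduct.map (augProj k C) (augProj k C) ∘ₗ Coalgebra.comul ∘ₗ (augIdeal k C).subtype

variable {k C}

theorem coe_augProj (x : C) : (augProj k C x : C) = x - Coalgebra.counit (R := k) x • (1 : C) := rfl

theorem augProj_subtype (x : augIdeal k C) : augProj k C x = x :=
  Subtype.ext (by rw [coe_augProj, LinearMap.mem_ker.1 x.2, zero_smul, sub_zero])

theorem subtype_reducedComul (x : augIdeal k C) :
    TensorProduct.map (augIdeal k C).subtype (augIdeal k C).subtype (reducedComul k C x) =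
      Coalgebra.comul (R := k) (x : C) - (x : C) ⊗ₜ 1 - 1 ⊗ₜ (x : C) := by
  have h : ∀ t : C ⊗[k] C, TensorProduct.map (augIdeal k C).subtype (augIdeal k C).subtype
      (TensorProduct.map (augProj k C) (augProj k C) t) =
      t - TensorProduct.rid k C (Coalgebra.counit.lTensor C t) ⊗ₜ 1 -
        1 ⊗ₜ TensorProduct.lid k C (Coalgebra.counit.rTensor C t) +
        LinearMap.mul' k k (TensorProduct.map Coalgebra.counit Coalgebra.counit t) •
          ((1 : C) ⊗ₜ[k] (1 : C)) := by
    intro t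
    induction t with
    | zero => simp
    | add a b ha hb =>
      simp only [map_add, ha, hb, TensorProduct.add_tmul, TensorProduct.tmul_add, add_smul]
      abel
    | tmul a b =>
      simp only [TensorProduct.map_tmul, Submodule.subtype_apply, coe_augProj,
        LinearMap.lTensor_tmul, LinearMap.rTensor_tmul, TensorProduct.rid_tmul,
        TensorProduct.lid_tmul, LinearMap.mul'_apply, TensorProduct.sub_tmul,
        TensorProduct.tmul_sub, TensorProduct.smul_tmul', TensorProduct.tmul_smul, mul_smul]
      simp only [smul_sub, TensorProduct.smul_tmul', smul_smul, mul_comm]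
      abel
  have h2 : LinearMap.mul' k k (TensorProduct.map Coalgebra.counit Coalgebra.counit
      (Coalgebra.comul (R := k) (x : C))) = 0 := by
    have := Coalgebra.rTensor_counit_comul (R := k) (x : C)
    rw [← LinearMap.lTensor_comp_rTensor, LinearMap.comp_apply, this, LinearMap.lTensor_tmul,
      LinearMap.mem_ker.1 x.2]
    simp
  rw [reducedComul, LinearMap.comp_apply, LinearMap.comp_apply, Submodule.subtype_apply, h, h2,
    Coalgebra.rTensor_counit_comul, Coalgebra.lTensor_counit_comul]
  simp
end

section
variable (k C : Type*) [Field k] [AddCommGroup C] [Module k C] [Coalgebra k C] [One C]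

/-- The cobar construction `ΩC = T(C⁺)` as an algebra. -/
abbrev Cobar : Type _ := TensorAlgebra k (augIdeal k C)

/-- The homogeneous part `(C⁺)^{⊗ n}` of the cobar construction. -/
abbrev Cobar.part (n : ℕ) : Submodule k (Cobar k C) :=
  LinearMap.range (ι k : augIdeal k C →ₗ[k] Cobar k C) ^ n

variable [IsCoaugmented k C]

/-- The differential on generators, `C⁺ → C⁺ ⊗ C⁺ ⊆ T(C⁺)`, `x ↦ -(Δ(x) - x ⊗ 1 - 1 ⊗ x)`. -/
def Cobar.dGen : augIdeal k C →ₗ[k] Cobar k C :=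
  -(LinearMap.mul' k (Cobar k C) ∘ₗ TensorProduct.map (ι k) (ι k) ∘ₗ reducedComul k C)

/-- The algebra map `x ↦ (σ(x), d(x); 0, x)` that encodes the derivation rule
`d(xy) = d(x) y + σ(x) d(y)` with `σ(x) = (-1)^{|x|} x`. -/
def Cobar.dMatrix : Cobar k C →ₐ[k] Matrix (Fin 2) (Fin 2) (Cobar k C) :=
  lift k
    { toFun := fun v => !![-ι k v, Cobar.dGen k C v; 0, ι k v]
      map_add' := fun v w => by ext i j; fin_cases i <;> fin_cases j <;> simp [add_comm]
      map_smul' := fun c v => by ext i j; fin_cases i <;> fin_cases j <;> simp }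

/-- The differential `∂` of the cobar construction, the derivation extending `Cobar.dGen`;
`Cobar.d_prod` shows that `∂ = ∑ i < n, (-1) ^ (i + 1) 1^{⊗ i} ⊗ Δ̄ ⊗ 1^{⊗ (n - i - 1)}` on
`(C⁺)^{⊗ n}`. -/
def Cobar.d : Cobar k C →ₗ[k] Cobar k C :=
  Matrix.entryLinearMap k (Cobar k C) 0 1 ∘ₗ (Cobar.dMatrix k C).toLinearMap

/-- The sign automorphism `x ↦ (-1)^{|x|} x`. -/
def Cobar.sign (k C : Type*) [Field k] [AddCommGroup C] [Module k C] [Coalgebra k C] :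
    Cobar k C →ₐ[k] Cobar k C := lift k (-ι k)

namespace Cobar
variable {k C}

theorem dMatrix_eq (x : Cobar k C) : dMatrix k C x = !![sign k C x, d k C x; 0, x] := by
  have h : ∀ x, dMatrix k C x 1 0 = 0 ∧ dMatrix k C x 0 0 = sign k C x ∧
      dMatrix k C x 1 1 = x := by
    intro x
    induction x using TensorAlgebra.induction with
    | algebraMap r => simp [Matrix.algebraMap_matrix_apply]
    | ι v => simp [dMatrix, sign]
    | mul a b ha hb => simp [Matrix.mul_apply, ha, hb]
    | add a b ha hb => simp [ha, hb]
  ext i j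
  fin_cases i <;> fin_cases j <;> simp [h, d]

theorem d_mul (x y : Cobar k C) : d k C (x * y) = d k C x * y + sign k C x * d k C y := by
  have h := congrFun₂ (map_mul (dMatrix k C) x y) 0 1
  simpa [dMatrix_eq, Matrix.mul_apply, add_comm] using h

theorem d_algebraMap (r : k) : d k C (algebraMap k _ r) = 0 := by
  simp [d, Matrix.algebraMap_matrix_apply]

theorem d_one : d k C 1 = 0 := by rw [← map_one (algebraMap k _), d_algebraMap]

theorem d_ι (v : augIdeal k C) : d k C (ι k v) = dGen k C v := by simp [d, dMatrix]

theorem sign_ι (v : augIdeal k C) : sign k C (ι k v) = -ι k v := by simp [sign]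

theorem d_prod (l : List (augIdeal k C)) : d k C (l.map (ι k)).prod =
    ∑ i : Fin l.length, (-1) ^ (i.val + 1) * (((l.take i).map (ι k)).prod *
      LinearMap.mul' k (Cobar k C) (TensorProduct.map (ι k) (ι k) (reducedComul k C l[i])) *
        ((l.drop (i + 1)).map (ι k)).prod) := by
  induction l with
  | nil => simp [d_one]
  | cons v l ih =>
    rw [List.map_cons, List.prod_cons, d_mul, ih, d_ι, sign_ι]
    simp only [List.length_cons]
    rw [Fin.sum_univ_succ]
    congr 1
    · simp [dGen]
    · rw [Finset.mul_sum]
      refine Finset.sum_congr rfl fun i _ => ?_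
      simp only [Fin.val_succ, List.take_succ_cons, List.map_cons, List.prod_cons,
        List.drop_succ_cons, Fin.getElem_fin, List.getElem_cons_succ]
      rcases neg_one_pow_eq_or (Cobar k C) (i.val + 1) with h | h <;>
        simp [pow_succ _ (i.val + 1), h, mul_assoc]

theorem sign_sign (x : Cobar k C) : sign k C (sign k C x) = x := by
  have : (sign k C).comp (sign k C) = AlgHom.id k _ := by ext v; simp [sign]
  exact AlgHom.congr_fun this x

theorem sign_dGen (v : augIdeal k C) : sign k C (dGen k C v) = dGen k C v := by
  simp only [dGen, LinearMap.neg_apply, LinearMap.comp_apply, map_neg]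
  generalize reducedComul k C v = t
  congr 1
  induction t with
  | zero => simp
  | add a b ha hb => simp [ha, hb]
  | tmul a b => simp [sign]

theorem d_sign (x : Cobar k C) : d k C (sign k C x) = -sign k C (d k C x) := by
  induction x using TensorAlgebra.induction with
  | algebraMap r => simp [d_algebraMap]
  | ι v => simp [sign_ι, d_ι, sign_dGen]
  | mul a b ha hb => simp only [map_mul, d_mul, ha, hb, map_add, sign_sign]; simp; abel
  | add a b ha hb => simp only [map_add, ha, hb, neg_add]

theorem reducedComul_coassoc (v : augIdeal k C) :
    TensorProduct.assoc k _ _ _ ((reducedComul k C).rTensor _ (reducedComul k C v)) =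
      (reducedComul k C).lTensor _ (reducedComul k C v) := by
  have hp : ∀ x : C, reducedComul k C (augProj k C x) =
      TensorProduct.map (augProj k C) (augProj k C) (Coalgebra.comul x) := by
    intro x
    have h1 : augProj k C 1 = 0 := Subtype.ext (by simp [coe_augProj, IsCoaugmented.counit_one])
    rw [reducedComul, LinearMap.comp_apply, LinearMap.comp_apply, Submodule.subtype_apply,
      coe_augProj, map_sub, map_sub, map_smul, map_smul, IsCoaugmented.comul_one,
      TensorProduct.map_tmul, h1, TensorProduct.tmul_zero, smul_zero, sub_zero]
  have hL : ∀ t : C ⊗[k] C, TensorProduct.assoc k _ _ _ ((reducedComul k C).rTensor _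
      (TensorProduct.map (augProj k C) (augProj k C) t)) =
      TensorProduct.map (augProj k C) (TensorProduct.map (augProj k C) (augProj k C))
        (TensorProduct.assoc k _ _ _ (Coalgebra.comul.rTensor _ t)) := by
    intro t
    rw [← LinearEquiv.coe_toLinearMap, ← LinearEquiv.coe_toLinearMap,
      ← LinearMap.comp_apply (TensorProduct.map (augProj k C) _),
      TensorProduct.map_map_comp_assoc_eq, LinearMap.comp_apply]
    congr 1
    induction t with
    | zero => simp only [map_zero]
    | add a b ha hb => simp only [map_add, ha, hb]
    | tmul a b => simp only [TensorProduct.map_tmul, LinearMap.rTensor_tmul, hp]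
  have hR : ∀ t : C ⊗[k] C, (reducedComul k C).lTensor _
      (TensorProduct.map (augProj k C) (augProj k C) t) =
      TensorProduct.map (augProj k C) (TensorProduct.map (augProj k C) (augProj k C))
        (Coalgebra.comul.lTensor _ t) := by
    intro t
    induction t with
    | zero => simp only [map_zero]
    | add a b ha hb => simp only [map_add, ha, hb]
    | tmul a b => simp only [TensorProduct.map_tmul, LinearMap.lTensor_tmul, hp]
  conv_lhs => rw [reducedComul, LinearMap.comp_apply, LinearMap.comp_apply]
  rw [← reducedComul, hL, Coalgebra.coassoc_apply, ← hR]
  rfl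

theorem d_dGen (v : augIdeal k C) : d k C (dGen k C v) = 0 := by
  have h1 : ∀ t : augIdeal k C ⊗[k] augIdeal k C,
      d k C (LinearMap.mul' k _ (TensorProduct.map (ι k) (ι k) t)) =
      LinearMap.mul' k (Cobar k C) (TensorProduct.map (ι k)
        (LinearMap.mul' k (Cobar k C) ∘ₗ TensorProduct.map (ι k) (ι k))
        ((reducedComul k C).lTensor _ t -
          TensorProduct.assoc k _ _ _ ((reducedComul k C).rTensor _ t))) := by
    intro t
    induction t with
    | zero => simp
    | add a b ha hb =>
      simp only [map_add, map_sub, ha, hb]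
      abel
    | tmul a b =>
      have h : ∀ s : augIdeal k C ⊗[k] augIdeal k C,
          LinearMap.mul' k (Cobar k C) (TensorProduct.map (ι k)
            (LinearMap.mul' k (Cobar k C) ∘ₗ TensorProduct.map (ι k) (ι k))
            (TensorProduct.assoc k _ _ _ (s ⊗ₜ b))) =
          LinearMap.mul' k _ (TensorProduct.map (ι k) (ι k) s) * ι k b := by
        intro s
        induction s with
        | zero => simp
        | add x y hx hy => simp only [map_add, TensorProduct.add_tmul, hx, hy, add_mul]
        | tmul x y => simp [mul_assoc]
      rw [map_sub, map_sub, LinearMap.rTensor_tmul, h]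
      simp only [TensorProduct.map_tmul, LinearMap.mul'_apply, d_mul, d_ι, sign_ι,
        LinearMap.lTensor_tmul, dGen, LinearMap.neg_apply, LinearMap.comp_apply]
      simp
      abel
  rw [dGen, LinearMap.neg_apply, map_neg, LinearMap.comp_apply, LinearMap.comp_apply, h1,
    reducedComul_coassoc, sub_self, map_zero, map_zero, neg_zero]

theorem d_d (x : Cobar k C) : d k C (d k C x) = 0 := by
  induction x using TensorAlgebra.induction with
  | algebraMap r => rw [d_algebraMap, map_zero]
  | ι v => rw [d_ι, d_dGen]
  | mul a b ha hb =>
    rw [d_mul, map_add, d_mul, d_mul, ha, hb, d_sign, zero_mul, mul_zero]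
    simp
  | add a b ha hb => rw [map_add, map_add, ha, hb, add_zero]

theorem d_mem_part {n : ℕ} {x : Cobar k C} (hx : x ∈ part k C n) : d k C x ∈ part k C (n + 1) := by
  have hgen : ∀ v, dGen k C v ∈ part k C 2 := by
    intro v
    rw [dGen, LinearMap.neg_apply, LinearMap.comp_apply, LinearMap.comp_apply]
    refine neg_mem ?_
    generalize reducedComul k C v = t
    induction t with
    | zero => simp only [map_zero, zero_mem]
    | add a b ha hb => simp only [map_add]; exact add_mem ha hb
    | tmul a b =>
      rw [part, pow_two]
      exact Submodule.mul_mem_mul ⟨a, rfl⟩ ⟨b, rfl⟩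
  induction hx using Submodule.pow_induction_on_left' with
  | algebraMap r => rw [d_algebraMap]; exact zero_mem _
  | add x y i hx hy ihx ihy => rw [map_add]; exact add_mem ihx ihy
  | mem_mul m hm i x hx ih =>
    obtain ⟨v, rfl⟩ := hm
    rw [d_mul, d_ι, sign_ι, neg_mul]
    refine add_mem ?_ (neg_mem ?_)
    · have := Submodule.mul_mem_mul (hgen v) hx
      rwa [← pow_add, show 2 + i = i + 1 + 1 by omega] at this
    · have := Submodule.mul_mem_mul (LinearMap.mem_range_self (ι k) v) ih
      rwa [← pow_succ'] at this

/-- A coboundary of degree `n + 1` is the differential of an element of degree `n`. Hence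
`CobarCohomology.degree` below is `Ker ∂ⁿ / Im ∂ⁿ⁻¹`. -/
theorem exists_part_of_d_mem {n : ℕ} {y : Cobar k C} (h : d k C y ∈ part k C (n + 1)) :
    ∃ y' ∈ part k C n, d k C y' = d k C y := by
  classical
  let P := DirectSum.decompose (part k C)
  refine ⟨P y n, (P y n).2, ?_⟩
  have key : ∀ x : Cobar k C, d k C (P x n) = (P (d k C x) (n + 1) : Cobar k C) := by
    intro x
    induction x using DirectSum.Decomposition.inductionOn (part k C) with
    | zero => simp [P]
    | add a b ha hb => simp only [P, DirectSum.decompose_add, map_add, DirectSum.add_apply,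
        Submodule.coe_add] at ha hb ⊢; rw [ha, hb]
    | @homogeneous i m =>
      by_cases hi : i = n
      · subst hi
        rw [DirectSum.decompose_of_mem_same _ m.2,
          DirectSum.decompose_of_mem_same _ (d_mem_part m.2)]
      · rw [DirectSum.decompose_of_mem_ne _ m.2 hi,
          DirectSum.decompose_of_mem_ne _ (d_mem_part m.2) (by omega), map_zero]
  rw [key, DirectSum.decompose_of_mem_same _ h]

variable (k C) in
/-- The algebra of cocycles `Ker ∂`. -/
def cocycles : Subalgebra k (Cobar k C) where
  carrier := {x | d k C x = 0}
  mul_mem' := fun {x y} hx hy => by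
    change d k C (x * y) = 0
    rw [d_mul, show d k C x = 0 from hx, show d k C y = 0 from hy, zero_mul, mul_zero, add_zero]
  add_mem' := fun {x y} hx hy => by
    change d k C (x + y) = 0
    rw [map_add, show d k C x = 0 from hx, show d k C y = 0 from hy, add_zero]
  algebraMap_mem' := d_algebraMap

theorem mem_cocycles {x : Cobar k C} : x ∈ cocycles k C ↔ d k C x = 0 := Iff.rfl

variable (k C) in
/-- The ideal of coboundaries `Im ∂` in the algebra of cocycles. -/
def coboundaries : Ideal (cocycles k C) where
  carrier := {z | ∃ y, d k C y = (z : Cobar k C)}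
  add_mem' := by
    rintro _ _ ⟨x, hx⟩ ⟨y, hy⟩
    exact ⟨x + y, by rw [map_add, hx, hy]; rfl⟩
  zero_mem' := ⟨0, map_zero _⟩
  smul_mem' := fun z x hx => by
    obtain ⟨y, hy⟩ := hx
    refine ⟨sign k C z * y, ?_⟩
    rw [d_mul, d_sign, mem_cocycles.1 z.2, map_zero, neg_zero, zero_mul, zero_add, sign_sign, hy]
    rfl

theorem mem_coboundaries {z : cocycles k C} :
    z ∈ coboundaries k C ↔ ∃ y, d k C y = (z : Cobar k C) := Iff.rfl

instance : (coboundaries k C).IsTwoSided where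
  mul_mem_of_left := fun {x} z hx => by
    obtain ⟨y, hy⟩ := mem_coboundaries.1 hx
    refine ⟨y * z, ?_⟩
    rw [d_mul, mem_cocycles.1 z.2, mul_zero, add_zero, hy]
    rfl

end Cobar

/-- The cohomology algebra `Ker ∂ / Im ∂` of the cobar construction of `C`. -/
def CobarCohomology : Type _ := Cobar.cocycles k C ⧸ Cobar.coboundaries k C

namespace CobarCohomology

instance : Ring (CobarCohomology k C) :=
  inferInstanceAs (Ring (Cobar.cocycles k C ⧸ Cobar.coboundaries k C))

instance : Algebra k (CobarCohomology k C) :=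
  inferInstanceAs (Algebra k (Cobar.cocycles k C ⧸ Cobar.coboundaries k C))

/-- The class of a cocycle. -/
def mk : Cobar.cocycles k C →ₐ[k] CobarCohomology k C :=
  Ideal.Quotient.mkₐ k (Cobar.coboundaries k C)

theorem mk_surjective : Function.Surjective (mk k C) := Ideal.Quotient.mkₐ_surjective k _

variable {k C} in
theorem mk_eq_zero {z : Cobar.cocycles k C} : mk k C z = 0 ↔ z ∈ Cobar.coboundaries k C :=
  Ideal.Quotient.eq_zero_iff_mem

/-- The cohomology `Hⁿ` in degree `n`: the classes of the cocycles in `(C⁺)^{⊗ n}`. -/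
def degree (n : ℕ) : Submodule k (CobarCohomology k C) :=
  ((Cobar.part k C n).comap (Cobar.cocycles k C).val.toLinearMap).map (mk k C).toLinearMap

end CobarCohomology
end
end CobarSection


section CoactionSection
open GroupComodule YetterDrinfeld TensorAlgebra

/-- A coaugmented coalgebra whose structure maps are `k[G]`-colinear. -/
class IsComoduleCoalgebra (k G C : Type*) [Field k] [Group G] [AddCommGroup C] [Module k C]
    [Coalgebra k C] [One C] [GroupComodule k G C] : Prop where
  coact_one : coact (k := k) (G := G) (1 : C) = 1 ⊗ₜ 1
  coact_comul : ∀ x : C, coactTensor k G C C (Coalgebra.comul (R := k) x) =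
    (Coalgebra.comul (R := k)).lTensor _ (coact (k := k) (G := G) x)
  coact_counit : ∀ x : C, (TensorProduct.rid k _) ((Coalgebra.counit (R := k)).lTensor _
    (coact (k := k) (G := G) x)) = Coalgebra.counit (R := k) x • (1 : MonoidAlgebra k G)

section
variable (k G C : Type*) [Field k] [Group G] [AddCommGroup C] [Module k C]
    [Coalgebra k C] [One C] [IsCoaugmented k C] [GroupComodule k G C] [IsComoduleCoalgebra k G C]

variable {k G C} in
theorem coact_augProj (x : C) :
    (augProj k C).lTensor _ (coact (k := k) (G := G) (augProj k C x : C)) =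
      (augProj k C).lTensor _ (coact (k := k) (G := G) x) := by
  have h1 : augProj k C 1 = 0 := Subtype.ext (by simp [coe_augProj, IsCoaugmented.counit_one])
  rw [coe_augProj, map_sub, map_sub, map_smul, map_smul, IsComoduleCoalgebra.coact_one,
    LinearMap.lTensor_tmul, h1, TensorProduct.tmul_zero, smul_zero, sub_zero]

/-- The coaction on `C⁺`, the restriction of the coaction of `C` (see `subtype_coact`). -/
instance : GroupComodule k G (augIdeal k C) where
  coact := (augProj k C).lTensor _ ∘ₗ coact (k := k) (G := G) (V := C) ∘ₗ (augIdeal k C).subtype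
  coassoc := by
    refine LinearMap.ext fun y => ?_
    obtain ⟨x, rfl⟩ : ∃ x : C, augProj k C x = y := ⟨y, augProj_subtype y⟩
    simp only [LinearMap.comp_apply, Submodule.subtype_apply, coact_augProj]
    induction x using hom_induction k G (V := C) with
    | h0 => simp only [map_zero]
    | hadd x y hx hy => simp only [map_add, hx, hy]
    | h g x hx =>
      rw [mem_degreePart] at hx
      simp [hx, coact_augProj]
  counit := by
    refine LinearMap.ext fun y => ?_
    obtain ⟨x, rfl⟩ : ∃ x : C, augProj k C x = y := ⟨y, augProj_subtype y⟩
    simp only [LinearMap.comp_apply, Submodule.subtype_apply, coact_augProj]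
    induction x using hom_induction k G (V := C) with
    | h0 => simp only [map_zero]
    | hadd x y hx hy => simp only [map_add, hx, hy]
    | h g x hx =>
      rw [mem_degreePart] at hx
      simp [hx]

variable {k G C}

theorem coact_augProj' (x : C) : coact (k := k) (G := G) (augProj k C x) =
    (augProj k C).lTensor _ (coact (k := k) (G := G) x) := coact_augProj x

theorem augProj_mem {g : G} {x : C} (hx : x ∈ degreePart k G C g) :
    augProj k C x ∈ degreePart k G (augIdeal k C) g := by
  rw [mem_degreePart] at *
  rw [coact_augProj', hx, LinearMap.lTensor_tmul]

theorem subtype_coact (x : augIdeal k C) :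
    (augIdeal k C).subtype.lTensor _ (coact (k := k) (G := G) x) = coact (G := G) (x : C) := by
  have h : ∀ y : C, (augIdeal k C).subtype.lTensor _ (coact (k := k) (G := G) (augProj k C y)) =
      coact (G := G) (augProj k C y : C) := by
    intro y
    induction y using hom_induction k G (V := C) with
    | h0 => simp only [map_zero, ZeroMemClass.coe_zero]
    | hadd x y hx hy => simp only [map_add, hx, hy, Submodule.coe_add]
    | h g y hy =>
      have h1 := IsComoduleCoalgebra.coact_counit (k := k) (G := G) y
      rw [mem_degreePart] at hy
      rw [hy, LinearMap.lTensor_tmul, TensorProduct.rid_tmul] at h1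
      rw [coact_augProj', hy, LinearMap.lTensor_tmul, LinearMap.lTensor_tmul,
        Submodule.subtype_apply, coe_augProj, map_sub, map_smul, IsComoduleCoalgebra.coact_one, hy,
        TensorProduct.tmul_sub, TensorProduct.tmul_smul, TensorProduct.smul_tmul',
        TensorProduct.smul_tmul', h1]
  simpa only [augProj_subtype] using h x

theorem reducedComul_coact (x : augIdeal k C) :
    coactTensor k G _ _ (reducedComul k C x) =
      (reducedComul k C).lTensor _ (coact (k := k) (G := G) x) := by
  have h : ∀ t : C ⊗[k] C, coactTensor k G _ _ (TensorProduct.map (augProj k C) (augProj k C) t) =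
      (TensorProduct.map (augProj k C) (augProj k C)).lTensor _ (coactTensor k G _ _ t) := by
    intro t
    induction t with
    | zero => simp only [map_zero]
    | add a b ha hb => simp only [map_add, ha, hb]
    | tmul a b =>
      induction a using hom_induction k G (V := C) with
      | h0 => simp only [map_zero, TensorProduct.zero_tmul]
      | hadd x y hx hy => simp only [map_add, TensorProduct.add_tmul, hx, hy]
      | h g a ha =>
        induction b using hom_induction k G (V := C) with
        | h0 => simp only [map_zero, TensorProduct.tmul_zero]
        | hadd x y hx hy => simp only [map_add, TensorProduct.tmul_add, hx, hy]
        | h h b hb =>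
          rw [coactTensor_tmul ha hb, TensorProduct.map_tmul,
            coactTensor_tmul (augProj_mem ha) (augProj_mem hb)]
          rfl
  rw [reducedComul, LinearMap.comp_apply, LinearMap.comp_apply, Submodule.subtype_apply, h,
    IsComoduleCoalgebra.coact_comul, ← subtype_coact, ← LinearMap.lTensor_comp_apply,
    ← LinearMap.lTensor_comp_apply]
  rfl

namespace Cobar

theorem coact_dGen (v : augIdeal k C) : coact (k := k) (G := G) (dGen k C v) =
    (dGen k C).lTensor _ (coact (k := k) (G := G) v) := by
  have h : ∀ t : augIdeal k C ⊗[k] augIdeal k C, coact (k := k) (G := G)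
      (LinearMap.mul' k (Cobar k C) (TensorProduct.map (ι k) (ι k) t)) =
      (LinearMap.mul' k (Cobar k C) ∘ₗ TensorProduct.map (ι k) (ι k)).lTensor _
        (coactTensor k G _ _ t) := by
    intro t
    induction t with
    | zero => simp only [map_zero]
    | add a b ha hb => simp only [map_add, ha, hb]
    | tmul a b =>
      induction a using hom_induction k G (V := augIdeal k C) with
      | h0 => simp only [map_zero, TensorProduct.zero_tmul]
      | hadd x y hx hy => simp only [map_add, TensorProduct.add_tmul, hx, hy]
      | h g a ha =>
        induction b using hom_induction k G (V := augIdeal k C) with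
        | h0 => simp only [map_zero, TensorProduct.tmul_zero]
        | hadd x y hx hy => simp only [map_add, TensorProduct.tmul_add, hx, hy]
        | h h b hb =>
          have ha' := ι_mem ha
          have hb' := ι_mem hb
          have hab := TensorAlgebra.mul_mem ha' hb'
          rw [mem_degreePart] at hab
          rw [coactTensor_tmul ha hb, TensorProduct.map_tmul, LinearMap.mul'_apply, hab]
          rfl
  rw [dGen, LinearMap.neg_apply, map_neg, LinearMap.comp_apply, LinearMap.comp_apply, h,
    reducedComul_coact, ← LinearMap.lTensor_comp_apply, LinearMap.lTensor_neg, LinearMap.neg_apply,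
    LinearMap.comp_assoc]

/-- The differential of the cobar construction is colinear. -/
theorem coact_d (x : Cobar k C) : coact (k := k) (G := G) (d k C x) =
    (d k C).lTensor _ (coact (k := k) (G := G) x) := by
  induction x using induction_hom k G (V := augIdeal k C) with
  | h1 => rw [d_one, map_zero, coact_one, Algebra.TensorProduct.one_def, LinearMap.lTensor_tmul,
      d_one, TensorProduct.tmul_zero]
  | hsmul r x hx => simp only [map_smul, hx]
  | hadd x y hx hy => simp only [map_add, hx, hy]
  | hmul g v x hv hx =>
    have hι := ι_mem hv
    rw [mem_degreePart] at hv hι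
    rw [d_mul, d_ι, sign_ι, neg_mul, map_add, map_neg, coact_mul, coact_mul, coact_mul, hx,
      coact_dGen, hv, hι, LinearMap.lTensor_tmul]
    generalize coact (k := k) (G := G) x = t
    induction t with
    | zero => simp
    | add a b ha hb =>
      simp only [map_add, mul_add] at ha hb ⊢
      rw [← ha, ← hb]
      abel
    | tmul a b =>
      simp [d_mul, d_ι, sign_ι, TensorProduct.tmul_add, TensorProduct.tmul_neg]

/-- The inclusion `k[G] ⊗ Ker ∂ → k[G] ⊗ ΩC`. -/
def inclCocycles (k G C : Type*) [Field k] [Group G] [AddCommGroup C] [Module k C]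
    [Coalgebra k C] [One C] [IsCoaugmented k C] :
    MonoidAlgebra k G ⊗[k] cocycles k C →ₐ[k] MonoidAlgebra k G ⊗[k] Cobar k C :=
  Algebra.TensorProduct.map (AlgHom.id k _) (cocycles k C).val

theorem inclCocycles_injective : Function.Injective (inclCocycles k G C) :=
  Module.Flat.lTensor_preserves_injective_linearMap (M := MonoidAlgebra k G)
    (cocycles k C).val.toLinearMap Subtype.val_injective

theorem coact_mem_range (z : cocycles k C) :
    coact (k := k) (G := G) (z : Cobar k C) ∈ (inclCocycles k G C).range := by
  have h : coact (k := k) (G := G) (z : Cobar k C) ∈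
      LinearMap.ker ((d k C).lTensor (MonoidAlgebra k G)) := by
    rw [LinearMap.mem_ker, ← coact_d, mem_cocycles.1 z.2, map_zero]
  have h2 := Module.Flat.ker_lTensor_eq (S := k) (M := MonoidAlgebra k G) (d k C)
  have h3 : coact (k := k) (G := G) (z : Cobar k C) ∈
      LinearMap.ker (TensorProduct.AlgebraTensorModule.lTensor k (MonoidAlgebra k G) (d k C)) := h
  rw [h2] at h3
  obtain ⟨y, hy⟩ := h3
  exact ⟨y, hy⟩

variable (k G C) in
/-- The coaction on cocycles, the restriction of the one on `ΩC`. -/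
def coactCocycles : cocycles k C →ₐ[k] MonoidAlgebra k G ⊗[k] cocycles k C :=
  (AlgEquiv.ofInjective (inclCocycles k G C) inclCocycles_injective).symm.toAlgHom.comp
    (((coactHom k G (augIdeal k C)).comp (cocycles k C).val).codRestrict _ coact_mem_range)

theorem incl_coactCocycles (z : cocycles k C) :
    inclCocycles k G C (coactCocycles k G C z) = coact (k := k) (G := G) (z : Cobar k C) := by
  have := (AlgEquiv.ofInjective (inclCocycles k G C) inclCocycles_injective).apply_symm_apply
    (((coactHom k G (augIdeal k C)).comp (cocycles k C).val).codRestrict _ coact_mem_range z)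
  exact congrArg Subtype.val this

end Cobar

namespace CobarCohomology

variable (k G C) in
/-- The coaction on the cohomology algebra, induced by the one on cocycles. -/
def coactHom : CobarCohomology k C →ₐ[k] MonoidAlgebra k G ⊗[k] CobarCohomology k C :=
  Ideal.Quotient.liftₐ (Cobar.coboundaries k C)
    ((Algebra.TensorProduct.map (AlgHom.id k _) (mk k C)).comp (Cobar.coactCocycles k G C))
    fun z hz => by
      obtain ⟨y, hy⟩ := Cobar.mem_coboundaries.1 hz
      let d' : Cobar k C →ₗ[k] Cobar.cocycles k C :=
        (Cobar.d k C).codRestrict (Subalgebra.toSubmodule (Cobar.cocycles k C)) Cobar.d_d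
      have h1 : Cobar.coactCocycles k G C z = d'.lTensor _ (coact (k := k) (G := G) y) := by
        apply Cobar.inclCocycles_injective
        rw [Cobar.incl_coactCocycles, ← hy, Cobar.coact_d]
        generalize coact (k := k) (G := G) y = t
        induction t with
        | zero => simp only [map_zero]
        | add a b ha hb => simp only [map_add, ha, hb]
        | tmul a b => rfl
      rw [AlgHom.comp_apply, h1]
      generalize coact (k := k) (G := G) y = t
      induction t with
      | zero => simp only [map_zero]
      | add a b ha hb => simp only [map_add, ha, hb, add_zero]
      | tmul a b =>
        have : mk k C (d' b) = 0 := mk_eq_zero.2 ⟨b, rfl⟩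
        simp [this]

theorem coactHom_mk (z : Cobar.cocycles k C) : coactHom k G C (mk k C z) =
    Algebra.TensorProduct.map (AlgHom.id k _) (mk k C) (Cobar.coactCocycles k G C z) := rfl

theorem hom_induction_mk {P : CobarCohomology k C → Prop} (h0 : P 0)
    (hadd : ∀ x y, P x → P y → P (x + y))
    (h : ∀ (g : G) (z : Cobar.cocycles k C),
      Cobar.coactCocycles k G C z = MonoidAlgebra.single g (1 : k) ⊗ₜ z → P (mk k C z))
    (x : CobarCohomology k C) : P x := by
  obtain ⟨z, rfl⟩ := mk_surjective k C x
  obtain ⟨f, hf⟩ := exists_finsupp_repr (Cobar.coactCocycles k G C z)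
  have h1 : coact (k := k) (G := G) (z : Cobar k C) =
      ∑ g ∈ f.support, MonoidAlgebra.single g (1 : k) ⊗ₜ[k] (f g : Cobar k C) := by
    rw [← Cobar.incl_coactCocycles, hf, Finsupp.sum, map_sum]
    rfl
  obtain ⟨h2, h3⟩ := of_coact_eq_sum h1
  have h4 : z = ∑ g ∈ f.support, f g := Subtype.ext (by rw [h3]; simp)
  rw [h4, map_sum]
  refine Finset.sum_induction _ P hadd h0 fun g hg => h g _ ?_
  apply Cobar.inclCocycles_injective
  rw [Cobar.incl_coactCocycles, mem_degreePart.1 (h2 g hg)]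
  rfl

instance : GroupComodule k G (CobarCohomology k C) where
  coact := (coactHom k G C).toLinearMap
  coassoc := LinearMap.ext fun x => by
    induction x using hom_induction_mk (k := k) (G := G) (C := C) with
    | h0 => simp only [map_zero]
    | hadd x y hx hy => simp only [map_add, hx, hy]
    | h g z hz => simp [coactHom_mk, hz]
  counit := LinearMap.ext fun x => by
    induction x using hom_induction_mk (k := k) (G := G) (C := C) with
    | h0 => simp only [map_zero]
    | hadd x y hx hy => simp only [map_add, hx, hy]
    | h g z hz => simp [coactHom_mk, hz]

variable (k G C) in
/-- The subalgebra of `k[G]`-coinvariants, that is, the part of trivial `G`-grading. -/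
def coinvariants : Subalgebra k (CobarCohomology k C) where
  carrier := degreePart k G (CobarCohomology k C) 1
  mul_mem' := fun {x y} hx hy => by
    rw [SetLike.mem_coe, mem_degreePart] at *
    change coactHom k G C (x * y) = _
    rw [map_mul]
    change coact x * coact y = _
    rw [hx, hy, Algebra.TensorProduct.tmul_mul_tmul]
    simp
  add_mem' := fun hx hy => add_mem (S := Submodule k _) hx hy
  algebraMap_mem' := fun r => by
    rw [SetLike.mem_coe, mem_degreePart]
    exact ((coactHom k G C).commutes r).trans (Algebra.TensorProduct.algebraMap_apply' r)

end CobarCohomology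
end

/-! The two coalgebras to which the construction is applied. -/

section
variable (k G V : Type*) [Field k] [Group G] [AddCommGroup V] [Module k V] [YetterDrinfeld k G V]

instance : IsCoaugmented k (NicholsAlgebra k G V) where
  counit_one := BraidedBialgebra.counit_one (G := G)
  comul_one := BraidedBialgebra.comul_one (G := G)

instance : IsComoduleCoalgebra k G (NicholsAlgebra k G V) where
  coact_one := BraidedBialgebra.coact_one
  coact_comul := BraidedBialgebra.coact_comul
  coact_counit := BraidedBialgebra.coact_counit

instance (R : Type*) [Ring R] [Algebra k R] [YetterDrinfeld k G R] [Coalgebra k R]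
    [BraidedBialgebra k G R] : IsCoaugmented k (Bosonization k G R) where
  counit_one := Bosonization.counit_one
  comul_one := Bosonization.comul_one
end
end CoactionSection

end

set_option linter.unusedSectionVars false

/-! Let R be a bialgebra in Yetter–Drinfeld modules, such as B(V), and let C = R # k[G]. The
coalgebra C behaves like a path coalgebra with vertex set G: each 1 # g is grouplike, and r # y with
r ∈ R⁺ of degree h is an edge from h y to y, because Δ(r # y) contains (1 # h y) ⊗ (r # y) and (r #
y) ⊗ (1 # y). The cohomology of ΩC is Ext over C from the vertex 1 to itself. As k[G] is
cosemisimple, this Ext can be computed from the closed paths at 1 alone, without the letters 1 # g −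
1 # 1. A word r₁ ⋯ rₙ of homogeneous elements of R⁺ lifts to exactly one path that ends at 1, and
this path starts at the product of the degrees. Hence the closed paths at 1 form the part of ΩR of
trivial degree.

The proof makes this explicit. The isomorphism is induced by the coalgebra map r # g ↦ r, hence by a
morphism f : ΩC → ΩR of differential graded algebras; this gives multiplicativity. In the other
direction `pathMatrix` is an algebra map P from ΩR to matrices over ΩC whose entry (x, y) collects
the paths from x to y. Put e_x = 1 # x − 1 # 1. Then d e_x = −e_x e_x (`dGen_groupElt`), and P
commutes with the differentials after a twist by the diagonal matrix e (`d_pathMatrix`). Since e_1 =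
0, the entry (1, 1) is an honest chain map (`d_pathMatrix_one`), and f(P(w)₁₁) is the part of w of
trivial degree (`map_forget_pathMatrix`).

It remains to see that paths suffice. For every vertex x, `homotopy` is an operator h_x on ΩC with
D_x h_x + h_x D_x = id − (an entry (x, 1) of some P(u)), where D_x = d + e_x (`exists_homotopy`).
All vertices are needed at once, because passing an edge moves the induction to another vertex. At x
= 1 it follows that every cocycle of ΩC is some P(u)₁₁ up to a coboundary (`exists_of_d_eq_zero`).
That f lands in the coinvariants, is injective on cohomology and reaches every coinvariant class are
then short consequences; the degrees match because f and P both preserve word length. -/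

noncomputable section

/-! ### Homogeneous projections of a comodule and of the tensor algebra. -/

namespace GroupComodule
open TensorAlgebra

section
variable (k : Type*) {G V : Type*} [Field k] [Group G] [AddCommGroup V] [Module k V]
  [GroupComodule k G V]

/-- The projection of a comodule onto its homogeneous part of degree `g`. -/
def degreeProj (g : G) : V →ₗ[k] V :=
  (TensorProduct.lid k V).toLinearMap ∘ₗ
    (Finsupp.lapply g ∘ₗ (MonoidAlgebra.coeffLinearEquiv k).toLinearMap).rTensor V ∘ₗ
    coact (k := k) (G := G)

variable {k}

theorem degreeProj_of_mem [DecidableEq G] {h : G} {v : V} (hv : v ∈ degreePart k G V h) (g : G) :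
    degreeProj k g v = if h = g then v else 0 := by
  rw [mem_degreePart] at hv
  simp [degreeProj, hv, Finsupp.single_apply, ite_smul]

theorem degreeProj_mem (g : G) (v : V) : degreeProj k g v ∈ degreePart k G V g := by
  classical
  induction v using hom_induction k G (V := V) with
  | h0 => simp
  | hadd x y hx hy => rw [map_add]; exact add_mem hx hy
  | h h v hv =>
    rw [degreeProj_of_mem hv]
    split_ifs with hg
    · exact hg ▸ hv
    · exact zero_mem _

end
end GroupComodule

namespace TensorAlgebra
open GroupComodule
variable {k G V : Type*} [Field k] [Group G] [AddCommGroup V] [Module k V]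

/-- Induction on words by their first letter. The path matrices and the homotopy obey recursions of
this shape. -/
theorem induction_ι_mul {P : TensorAlgebra k V → Prop} (h1 : P 1)
    (hsmul : ∀ (r : k) x, P x → P (r • x)) (hadd : ∀ x y, P x → P y → P (x + y))
    (hmul : ∀ (v : V) x, P x → P (ι k v * x)) (x : TensorAlgebra k V) : P x := by
  suffices h : ∀ y, P y → P (x * y) by simpa using h 1 h1
  induction x using TensorAlgebra.induction with
  | algebraMap r => intro y hy; rw [← Algebra.smul_def]; exact hsmul r y hy
  | ι v => exact fun y hy => hmul v y hy
  | mul a b ha hb => intro y hy; rw [mul_assoc]; exact ha _ (hb _ hy)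
  | add a b ha hb => intro y hy; rw [add_mul]; exact hadd _ _ (ha _ hy) (hb _ hy)

variable [GroupComodule k G V]

/-- Left multiplication by an element of degree h carries degree h⁻¹ g to degree g; the side matters
as G need not be commutative. The entries (g, 1) of the path matrices satisfy the same recursion,
see `pathMatrix_ι_mul`. -/
theorem degreeProj_mul {h : G} {x : TensorAlgebra k V} (hx : x ∈ degreePart k G _ h) (g : G)
    (y : TensorAlgebra k V) : degreeProj k g (x * y) = x * degreeProj k (h⁻¹ * g) y := by
  classical
  induction y using hom_induction k G (V := TensorAlgebra k V) with
  | h0 => simp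
  | hadd x y hx hy => simp only [mul_add, map_add, hx, hy]
  | h m y hy =>
    rw [degreeProj_of_mem hy, degreeProj_of_mem (mul_mem hx hy)]
    simp only [eq_inv_mul_iff_mul_eq]
    split_ifs <;> simp

theorem degreeProj_one [DecidableEq G] (g : G) :
    degreeProj k g (1 : TensorAlgebra k V) = if g = 1 then 1 else 0 := by
  rw [degreeProj_of_mem (one_mem k G V)]
  simp only [eq_comm]

end TensorAlgebra

/-! ### The pieces R # g of the bosonization and the coalgebra projection onto R. -/

namespace Bosonization
open GroupComodule YetterDrinfeld

section
variable {k G R : Type*} [Field k] [Group G] [Ring R] [Algebra k R]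

variable (k R) in
/-- The linear map `r ↦ r # g`. -/
def of (g : G) : R →ₗ[k] Bosonization k G R :=
  (TensorProduct.mk k R (MonoidAlgebra k G)).flip (MonoidAlgebra.single g 1)

theorem induction_of {P : Bosonization k G R → Prop} (h0 : P 0)
    (hadd : ∀ x y, P x → P y → P (x + y)) (h : ∀ (g : G) (r : R), P (of k R g r))
    (x : Bosonization k G R) : P x :=
  induction (P := P) h0 hadd (fun r g => h g r) x

variable (k R) in
/-- The linear map with `r # g ↦ r` and `r # x ↦ 0` for `x ≠ g`. -/
def slice (g : G) : Bosonization k G R →ₗ[k] R :=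
  (TensorProduct.rid k R).toLinearMap ∘ₗ
    (Finsupp.lapply g ∘ₗ (MonoidAlgebra.coeffLinearEquiv k).toLinearMap).lTensor R

theorem slice_of [DecidableEq G] (g x : G) (r : R) :
    slice k R g (of k R x r) = if x = g then r else 0 := by
  change (TensorProduct.rid k R) ((Finsupp.lapply g ∘ₗ
    (MonoidAlgebra.coeffLinearEquiv k).toLinearMap).lTensor R
      (r ⊗ₜ[k] MonoidAlgebra.single x (1 : k))) = _
  simp [Finsupp.single_apply, ite_smul]

variable (k G R) in
/-- The linear map `r # g ↦ r`. -/
def forgetₗ : Bosonization k G R →ₗ[k] R :=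
  (TensorProduct.rid k R).toLinearMap ∘ₗ
    (Coalgebra.counit (R := k) (A := MonoidAlgebra k G)).lTensor R

theorem forgetₗ_of (g : G) (r : R) : forgetₗ k G R (of k R g r) = r := by
  change (TensorProduct.rid k R) (Coalgebra.counit.lTensor R
    (r ⊗ₜ[k] MonoidAlgebra.single g (1 : k))) = r
  simp

variable [YetterDrinfeld k G R] [Coalgebra k R] [BraidedBialgebra k G R]

theorem one_eq_of : (1 : Bosonization k G R) = of k R 1 1 := rfl

theorem counit_of (g : G) (r : R) :
    Coalgebra.counit (R := k) (of k R g r) = Coalgebra.counit (R := k) r := counitMap_tmul r g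

variable (k R) in
/-- The map `a ⊗ b ↦ a # b₍₋₁₎ g ⊗ b₍₀₎ # g`. -/
def spread' (g : G) : R ⊗[k] R →ₗ[k] Bosonization k G R ⊗[k] Bosonization k G R := spread k G R g

theorem spread'_tmul {h : G} {b : R} (hb : b ∈ degreePart k G R h) (g : G) (a : R) :
    spread' k R g (a ⊗ₜ b) = of k R (h * g) a ⊗ₜ of k R g b := spread_tmul hb g a

theorem comul_of (g : G) (r : R) :
    Coalgebra.comul (R := k) (of k R g r) = spread' k R g (Coalgebra.comul r) := comulMap_tmul r g

theorem counit_forgetₗ (x : Bosonization k G R) :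
    Coalgebra.counit (R := k) (forgetₗ k G R x) = Coalgebra.counit (R := k) x := by
  induction x using induction_of with
  | h0 => simp only [map_zero]
  | hadd x y hx hy => simp only [map_add, hx, hy]
  | h g r => rw [counit_of, forgetₗ_of]

/-- The smash coproduct differs from the coproduct of R only by the group factors b₍₋₁₎ g and g, and
these are forgotten. -/
theorem map_forgetₗ_comul (x : Bosonization k G R) :
    TensorProduct.map (forgetₗ k G R) (forgetₗ k G R) (Coalgebra.comul x) =
      Coalgebra.comul (forgetₗ k G R x) := by
  induction x using induction_of with
  | h0 => simp only [map_zero]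
  | hadd x y hx hy => simp only [map_add, hx, hy]
  | h g r =>
    rw [comul_of, forgetₗ_of]
    generalize (Coalgebra.comul r : R ⊗[k] R) = t
    induction t with
    | zero => simp only [map_zero]
    | add a b ha hb => simp only [map_add, ha, hb]
    | tmul a b =>
      induction b using hom_induction k G (V := R) with
      | h0 => simp only [map_zero, TensorProduct.tmul_zero]
      | hadd x y hx hy => simp only [map_add, TensorProduct.tmul_add, hx, hy]
      | h s b hb => rw [spread'_tmul hb, TensorProduct.map_tmul, forgetₗ_of, forgetₗ_of]

variable (k G R) in
/-- The projection `r # g ↦ r` as a morphism of coalgebras. -/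
def forget : Bosonization k G R →ₗc[k] R where
  __ := forgetₗ k G R
  counit_comp := LinearMap.ext counit_forgetₗ
  map_comp_comul := LinearMap.ext map_forgetₗ_comul

theorem forget_of (g : G) (r : R) : forget k G R (of k R g r) = r := forgetₗ_of g r

theorem forget_one : forget k G R 1 = 1 := forget_of 1 1

end
end Bosonization

/-! ### Functoriality of the cobar construction. -/

namespace Cobar
open TensorAlgebra
variable {k C D : Type*} [Field k] [AddCommGroup C] [Module k C] [Coalgebra k C] [One C]
  [IsCoaugmented k C] [AddCommGroup D] [Module k D] [Coalgebra k D] [One D]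
  [IsCoaugmented k D]

/-- The restriction `C⁺ → D⁺` of a morphism of coalgebras. -/
def augMap (f : C →ₗc[k] D) : augIdeal k C →ₗ[k] augIdeal k D :=
  (f.toLinearMap ∘ₗ (augIdeal k C).subtype).codRestrict _ fun x => by
    have := LinearMap.congr_fun f.counit_comp (x : C)
    exact this.trans x.2

theorem coe_augMap (f : C →ₗc[k] D) (x : augIdeal k C) : (augMap f x : D) = f x := rfl

/-- A coalgebra map that preserves 1 commutes with the projections x ↦ x − ε(x) 1, out of which the
reduced comultiplication is built. -/
theorem reducedComul_augMap {f : C →ₗc[k] D} (hf : f 1 = 1) (x : augIdeal k C) :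
    reducedComul k D (augMap f x) =
      TensorProduct.map (augMap f) (augMap f) (reducedComul k C x) := by
  have h1 : ∀ x, augProj k D (f x) = augMap f (augProj k C x) := fun x => by
    apply Subtype.ext
    have := LinearMap.congr_fun f.counit_comp x
    rw [coe_augMap, coe_augProj, coe_augProj, map_sub, map_smul, hf]
    exact congrArg (fun c : k => f x - c • (1 : D)) this
  have h2 : ∀ t, TensorProduct.map (augProj k D) (augProj k D)
      (TensorProduct.map f.toLinearMap f.toLinearMap t) =
      TensorProduct.map (augMap f) (augMap f)
        (TensorProduct.map (augProj k C) (augProj k C) t) := by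
    intro t
    induction t with
    | zero => simp only [map_zero]
    | add a b ha hb => simp only [map_add, ha, hb]
    | tmul a b => simpa using congrArg₂ (· ⊗ₜ ·) (h1 a) (h1 b)
  have h3 := LinearMap.congr_fun f.map_comp_comul (x : C)
  simp only [reducedComul, LinearMap.comp_apply, Submodule.subtype_apply, coe_augMap] at h3 ⊢
  rw [← h2, h3]
  rfl

/-- The algebra map `ΩC → ΩD` induced by a morphism of coalgebras. -/
def map (f : C →ₗc[k] D) : Cobar k C →ₐ[k] Cobar k D := lift k (ι k ∘ₗ augMap f)

theorem map_ι (f : C →ₗc[k] D) (v : augIdeal k C) : map f (ι k v) = ι k (augMap f v) := by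
  simp [map]

theorem map_mem_part (f : C →ₗc[k] D) {n : ℕ} {x : Cobar k C} (hx : x ∈ part k C n) :
    map f x ∈ part k D n := by
  induction hx using Submodule.pow_induction_on_left' with
  | algebraMap r => rw [AlgHom.commutes, part, pow_zero]; exact Submodule.algebraMap_mem r
  | add x y i hx hy ihx ihy => rw [map_add]; exact add_mem ihx ihy
  | mem_mul m hm i x hx ih =>
    obtain ⟨v, rfl⟩ := hm
    rw [map_mul, map_ι, part, pow_succ']
    exact Submodule.mul_mem_mul ⟨_, rfl⟩ ih

theorem d_map {f : C →ₗc[k] D} (hf : f 1 = 1) (x : Cobar k C) :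
    d k D (map f x) = map f (d k C x) := by
  induction x using induction_ι_mul with
  | h1 => simp [d_one]
  | hsmul r x hx => simp only [map_smul, hx]
  | hadd x y hx hy => simp only [map_add, hx, hy]
  | hmul v x hx =>
    have h : dGen k D (augMap f v) = map f (dGen k C v) := by
      simp only [dGen, LinearMap.neg_apply, LinearMap.comp_apply, map_neg, reducedComul_augMap hf]
      congr 1
      generalize reducedComul k C v = t
      induction t with
      | zero => simp only [map_zero]
      | add a b ha hb => simp only [map_add, ha, hb]
      | tmul a b => simp [map_ι]
    rw [map_mul, map_ι, d_mul, d_mul, hx, d_ι, d_ι, sign_ι, sign_ι, h]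
    simp [map_ι]

end Cobar

/-! ### Edges and vertices: the differential on the generators of the cobar construction of R #
k[G]. -/

namespace Bosonization
open GroupComodule YetterDrinfeld TensorAlgebra Cobar

variable {k G R : Type*} [Field k] [Group G] [Ring R] [Algebra k R] [YetterDrinfeld k G R]
  [Coalgebra k R] [BraidedBialgebra k G R]

variable (k R) in
/-- The linear map `R⁺ → (R # k[G])⁺`, `r ↦ r # g`. -/
def ofAug (g : G) : augIdeal k R →ₗ[k] augIdeal k (Bosonization k G R) :=
  (of k R g ∘ₗ (augIdeal k R).subtype).codRestrict _ fun r => (counit_of g (r : R)).trans r.2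

theorem coe_ofAug (g : G) (r : augIdeal k R) : (ofAug k R g r : Bosonization k G R) = of k R g r :=
  rfl

variable (k R) in
/-- The element `1 # g - 1 # 1`. -/
def groupElt (g : G) : augIdeal k (Bosonization k G R) := augProj k _ (of k R g 1)

theorem groupElt_one : groupElt k R (1 : G) = 0 := by
  apply Subtype.ext
  rw [groupElt, ← one_eq_of, coe_augProj, IsCoaugmented.counit_one, one_smul, sub_self]
  rfl

variable [IsCoaugmented k R]

theorem coe_groupElt (g : G) : (groupElt k R g : Bosonization k G R) = of k R g 1 - of k R 1 1 := by
  rw [groupElt, coe_augProj, counit_of, IsCoaugmented.counit_one, one_smul, one_eq_of]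

/-- Splitting r into its augmentation part and the scalar ε(r) separates an edge r # g from a
multiple of the vertex element 1 # g − 1 # 1. -/
theorem augProj_of (g : G) (r : R) : augProj k _ (of k R g r) =
    ofAug k R g (augProj k R r) + Coalgebra.counit (R := k) r • groupElt k R g := by
  apply Subtype.ext
  rw [Submodule.coe_add, Submodule.coe_smul, coe_groupElt, coe_ofAug, coe_augProj, coe_augProj,
    counit_of, map_sub, map_smul, one_eq_of, smul_sub]
  abel

theorem augProj_ofAug (g : G) (r : augIdeal k R) :
    augProj k _ (of k R g r) = ofAug k R g r := augProj_subtype (ofAug k R g r)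

theorem augMap_forget_ofAug (g : G) (r : augIdeal k R) :
    augMap (forget k G R) (ofAug k R g r) = r :=
  Subtype.ext ((coe_augMap _ _).trans (forget_of g (r : R)))

variable [IsComoduleCoalgebra k G R]

/-- The augmentation ideal is spanned by the edges and the elements 1 # g − 1 # 1. An edge is
written through a projection, with source y and target x explicit, so that it has the form of an
entry of `pathMatrix`. -/
theorem augIdeal_induction {P : augIdeal k (Bosonization k G R) → Prop} (h0 : P 0)
    (hadd : ∀ x y, P x → P y → P (x + y)) (hsmul : ∀ (c : k) x, P x → P (c • x))
    (hof : ∀ (y x : G) (r : augIdeal k R), P (ofAug k R x (degreeProj k (y * x⁻¹) r)))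
    (hgrp : ∀ g, P (groupElt k R g)) (c : augIdeal k (Bosonization k G R)) : P c := by
  classical
  suffices h : ∀ c : Bosonization k G R, P (augProj k _ c) by
    simpa only [augProj_subtype] using h c
  intro c
  induction c using induction_of with
  | h0 => rwa [map_zero]
  | hadd x y hx hy => rw [map_add]; exact hadd _ _ hx hy
  | h x r =>
    rw [augProj_of]
    refine hadd _ _ ?_ (hsmul _ _ (hgrp x))
    generalize augProj k R r = r
    induction r using hom_induction k G (V := augIdeal k R) with
    | h0 => rwa [map_zero]
    | hadd x y hx hy => rw [map_add]; exact hadd _ _ hx hy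
    | h h r hr =>
      -- For r of degree h the edge r # x has source y = h x; then y x⁻¹ = h and the projection
      -- fixes r.
      have := hof (h * x) x r
      rwa [degreeProj_of_mem hr, mul_inv_cancel_right, if_pos rfl] at this

/-- Both 1 # g and 1 # 1 are grouplike. The result is the Maurer–Cartan equation, which makes w ↦ d
w + e_g w, for e_g = 1 # g − 1 # 1, square to zero. -/
theorem dGen_groupElt (g : G) :
    dGen k _ (groupElt k R g) = -(ι k (groupElt k R g) * ι k (groupElt k R g)) := by
  have h1 : reducedComul k _ (groupElt k R g) = groupElt k R g ⊗ₜ groupElt k R g := by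
    have h2 : (1 : R) ∈ degreePart k G R 1 := by
      rw [mem_degreePart, BraidedBialgebra.coact_one]; rfl
    have h3 : ∀ x : G, Coalgebra.comul (R := k) (of k R x 1) = of k R x 1 ⊗ₜ of k R x 1 := by
      intro x
      rw [comul_of, IsCoaugmented.comul_one, spread'_tmul h2, one_mul]
    -- In Δ(1 # g − 1 # 1) = (1 # g) ⊗ (1 # g) − (1 # 1) ⊗ (1 # 1) the second tensor dies under the
    -- projection, which sends 1 # 1 to 0.
    have h4 := groupElt_one (k := k) (R := R) (G := G)
    rw [groupElt] at h4
    rw [reducedComul, LinearMap.comp_apply, LinearMap.comp_apply, Submodule.subtype_apply,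
      coe_groupElt, map_sub, map_sub, h3, h3, TensorProduct.map_tmul, TensorProduct.map_tmul, h4,
      TensorProduct.tmul_zero, sub_zero, groupElt]
  rw [dGen, LinearMap.neg_apply, LinearMap.comp_apply, LinearMap.comp_apply, h1]
  simp

variable (k R) in
/-- The map `a ⊗ b ↦ (a # b₍₋₁₎ g) (b₍₀₎ # g)` to the cobar construction. -/
def cobarSpread (g : G) : augIdeal k R ⊗[k] augIdeal k R →ₗ[k] Cobar k (Bosonization k G R) :=
  LinearMap.mul' k _ ∘ₗ TensorProduct.map (ι k ∘ₗ augProj k _) (ι k ∘ₗ augProj k _) ∘ₗ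
    spread' k R g ∘ₗ TensorProduct.map (augIdeal k R).subtype (augIdeal k R).subtype

theorem coe_mem {h : G} {r : augIdeal k R} (hr : r ∈ degreePart k G (augIdeal k R) h) :
    (r : R) ∈ degreePart k G R h := by
  rw [mem_degreePart] at *
  rw [← subtype_coact, hr]
  simp

theorem cobarSpread_tmul {h : G} {b : augIdeal k R} (hb : b ∈ degreePart k G (augIdeal k R) h)
    (g : G) (a : augIdeal k R) :
    cobarSpread k R g (a ⊗ₜ b) = ι k (ofAug k R (h * g) a) * ι k (ofAug k R g b) := by
  simp only [cobarSpread, LinearMap.comp_apply, TensorProduct.map_tmul, Submodule.subtype_apply,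
    spread'_tmul (coe_mem hb), augProj_ofAug, LinearMap.mul'_apply]

/-- The reduced part of Δ(r) gives the quadratic term. The outer terms 1 ⊗ r and r ⊗ 1 are spread to
tensors with the grouplikes at the source h g and the target g of the edge, and the projection turns
these into the two vertex elements. -/
theorem dGen_ofAug {h : G} {r : augIdeal k R} (hr : r ∈ degreePart k G (augIdeal k R) h) (g : G) :
    dGen k _ (ofAug k R g r) = -cobarSpread k R g (reducedComul k R r) -
      ι k (groupElt k R (h * g)) * ι k (ofAug k R g r) -
      ι k (ofAug k R g r) * ι k (groupElt k R g) := by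
  -- Only the second tensor factor determines the twist in `spread'`, so the three summands can be
  -- spread separately: the factor 1 has degree 1, the factor r has degree h.
  have h1 : Coalgebra.comul (R := k) (r : R) = TensorProduct.map (augIdeal k R).subtype
      (augIdeal k R).subtype (reducedComul k R r) + (r : R) ⊗ₜ 1 + 1 ⊗ₜ (r : R) := by
    rw [subtype_reducedComul]; abel
  have h2 : (1 : R) ∈ degreePart k G R 1 := by
    rw [mem_degreePart, BraidedBialgebra.coact_one]; rfl
  have h3 : dGen k _ (ofAug k R g r) = -(LinearMap.mul' k _ (TensorProduct.map
      (ι k ∘ₗ augProj k _) (ι k ∘ₗ augProj k _) (Coalgebra.comul (of k R g (r : R))))) := by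
    rw [dGen, LinearMap.neg_apply, LinearMap.comp_apply, LinearMap.comp_apply, reducedComul,
      TensorProduct.map_comp]
    rfl
  rw [h3, comul_of, h1]
  simp only [map_add, spread'_tmul h2, spread'_tmul (coe_mem hr), TensorProduct.map_tmul,
    LinearMap.comp_apply, augProj_ofAug, LinearMap.mul'_apply, one_mul, cobarSpread]
  rw [groupElt, groupElt]
  abel

variable (k G R) in
/-- The projection of `R⁺ ⊗ R⁺` onto its part of degree `g` for the diagonal grading. -/
def tensorProj (g : G) : augIdeal k R ⊗[k] augIdeal k R →ₗ[k] augIdeal k R ⊗[k] augIdeal k R :=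
  (TensorProduct.lid k _).toLinearMap ∘ₗ
    (Finsupp.lapply g ∘ₗ (MonoidAlgebra.coeffLinearEquiv k).toLinearMap).rTensor _ ∘ₗ
    coactTensor k G _ _

/-- This is the colinearity of the reduced comultiplication, read off in the coefficient of g. -/
theorem tensorProj_reducedComul (g : G) (r : augIdeal k R) :
    tensorProj k G R g (reducedComul k R r) = reducedComul k R (degreeProj k g r) := by
  rw [tensorProj, LinearMap.comp_apply, LinearMap.comp_apply, reducedComul_coact, degreeProj,
    LinearMap.comp_apply, LinearMap.comp_apply]
  generalize coact (k := k) (G := G) r = t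
  induction t with
  | zero => simp only [map_zero]
  | add a b ha hb => simp only [map_add, ha, hb]
  | tmul a b => simp

theorem tensorProj_tmul [DecidableEq G] {g h : G} {a b : augIdeal k R}
    (ha : a ∈ degreePart k G (augIdeal k R) g)
    (hb : b ∈ degreePart k G (augIdeal k R) h) (x : G) :
    tensorProj k G R x (a ⊗ₜ b) = if g * h = x then a ⊗ₜ b else 0 := by
  simp [tensorProj, coactTensor_tmul ha hb, Finsupp.single_apply, ite_smul]

/-! ### Path matrices: lifting words of ΩR to paths in the bosonization. -/

variable [Fintype G] [DecidableEq G]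

variable (k G R) in
/-- The algebra map `ΩR → Mat_G(Ω(R # k[G]))` that sends `r ∈ R⁺` to the matrix with entries
`r_{x y⁻¹} # y`, where `r_g` is the homogeneous part of degree `g`. -/
def pathMatrix : Cobar k R →ₐ[k] Matrix G G (Cobar k (Bosonization k G R)) :=
  lift k
    { toFun := fun r => .of fun x y => ι k (ofAug k R y (degreeProj k (x * y⁻¹) r))
      map_add' := fun v w => by ext i j; simp
      map_smul' := fun c v => by ext i j; simp }

theorem pathMatrix_ι (r : augIdeal k R) (x y : G) :
    pathMatrix k G R (ι k r) x y = ι k (ofAug k R y (degreeProj k (x * y⁻¹) r)) := by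
  simp [pathMatrix]

/-- Unique path lifting: only one edge with label r leaves x, and it ends at h⁻¹ x, so the matrix
product has a single nonzero summand. -/
theorem pathMatrix_ι_mul {h : G} {r : augIdeal k R} (hr : r ∈ degreePart k G (augIdeal k R) h)
    (w : Cobar k R) (x y : G) : pathMatrix k G R (ι k r * w) x y =
      ι k (ofAug k R (h⁻¹ * x) r) * pathMatrix k G R w (h⁻¹ * x) y := by
  rw [map_mul, Matrix.mul_apply, Finset.sum_eq_single (h⁻¹ * x)]
  · rw [pathMatrix_ι, degreeProj_of_mem hr, if_pos (by simp)]
  · intro z _ hz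
    rw [pathMatrix_ι, degreeProj_of_mem hr, if_neg, map_zero, map_zero, zero_mul]
    rintro rfl
    simp at hz
  · simp

/-- For homogeneous a and b, the two-edge path over a ⊗ b that ends at y is precisely the spread of
a ⊗ b at y, and it starts at x only if the total degree is x y⁻¹. Thus the quadratic term in
`dGen_ofAug` is itself an entry of a path matrix. -/
theorem pathMatrix_mul' (t : augIdeal k R ⊗[k] augIdeal k R) (x y : G) :
    pathMatrix k G R (LinearMap.mul' k (Cobar k R) (TensorProduct.map (ι k) (ι k) t)) x y =
      cobarSpread k R y (tensorProj k G R (x * y⁻¹) t) := by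
  induction t with
  | zero => simp
  | add a b ha hb => simp only [map_add, Matrix.add_apply, ha, hb]
  | tmul a b =>
    induction a using hom_induction k G (V := augIdeal k R) with
    | h0 => simp
    | hadd x y hx hy => simp only [map_add, TensorProduct.add_tmul, Matrix.add_apply, hx, hy]
    | h g a ha =>
      induction b using hom_induction k G (V := augIdeal k R) with
      | h0 => simp
      | hadd x y hx hy => simp only [map_add, TensorProduct.tmul_add, Matrix.add_apply, hx, hy]
      | h h b hb =>
        rw [TensorProduct.map_tmul, LinearMap.mul'_apply, pathMatrix_ι_mul ha, pathMatrix_ι,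
          degreeProj_of_mem hb, tensorProj_tmul ha hb]
        have : h = g⁻¹ * x * y⁻¹ ↔ g * h = x * y⁻¹ := by rw [mul_assoc, eq_inv_mul_iff_mul_eq]
        simp only [this]
        split_ifs with hgh
        · rw [cobarSpread_tmul hb, eq_inv_mul_of_mul_eq hgh]
          simp [mul_assoc]
        · simp

/-- This is `d_pathMatrix` for a single letter: the outer terms of `dGen_ofAug` sit at the source x
and the target y. -/
theorem d_ofAug_degreeProj (r : augIdeal k R) (x y : G) :
    d k _ (ι k (ofAug k R y (degreeProj k (x * y⁻¹) r))) = pathMatrix k G R (d k R (ι k r)) x y -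
      ι k (groupElt k R x) * ι k (ofAug k R y (degreeProj k (x * y⁻¹) r)) -
      ι k (ofAug k R y (degreeProj k (x * y⁻¹) r)) * ι k (groupElt k R y) := by
  rw [d_ι, dGen_ofAug (degreeProj_mem _ r), d_ι, dGen, LinearMap.neg_apply, LinearMap.comp_apply,
    LinearMap.comp_apply, map_neg, Matrix.neg_apply, pathMatrix_mul', tensorProj_reducedComul,
    inv_mul_cancel_right]

/-- `pathMatrix` is compatible with the differentials, the one of `Mat_G(Ω(R # k[G]))` being
twisted by the diagonal matrix with entries `groupElt k R x`. -/
theorem d_pathMatrix (w : Cobar k R) (x y : G) : d k _ (pathMatrix k G R w x y) =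
    pathMatrix k G R (d k R w) x y - ι k (groupElt k R x) * pathMatrix k G R w x y +
      pathMatrix k G R (sign k R w) x y * ι k (groupElt k R y) := by
  induction w using induction_ι_mul generalizing x with
  | h1 =>
    rw [d_one, map_one, map_one, map_one, map_zero, Matrix.one_apply]
    split_ifs with h
    · subst h; simp [d_one]
    · simp
  | hsmul c w hw =>
    simp only [map_smul, Matrix.smul_apply, hw, smul_add, smul_sub, mul_smul_comm, smul_mul_assoc]
  | hadd v w hv hw =>
    simp only [map_add, Matrix.add_apply, hv, hw, mul_add, add_mul]
    abel
  | hmul r w hw =>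
    rw [d_mul, sign_ι, map_mul (sign k R), sign_ι, neg_mul, neg_mul, map_add, map_neg, map_neg,
      map_mul, map_mul, map_mul, map_mul, Matrix.add_apply, Matrix.neg_apply, Matrix.neg_apply]
    simp only [Matrix.mul_apply, map_sum, d_mul, hw, pathMatrix_ι, d_ofAug_degreeProj, sign_ι,
      Finset.sum_mul, Finset.mul_sum, ← Finset.sum_add_distrib, ← Finset.sum_neg_distrib,
      ← Finset.sum_sub_distrib]
    -- For each intermediate vertex z, the first edge contributes −(edge) · e_z from its target,
    -- with e_z = 1 # z − 1 # 1, and the rest of the path contributes + (edge) · e_z from its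
    -- source, after the sign of the Leibniz rule. These cancel, and only the twists at the ends x
    -- and y survive.
    refine Finset.sum_congr rfl fun z _ => ?_
    noncomm_ring

/-- Every entry of the matrix of a letter is a letter, so word length is preserved. The comparison
of cohomological degrees rests on this. -/
theorem pathMatrix_mem_part {n : ℕ} {w : Cobar k R} (hw : w ∈ part k R n) (x y : G) :
    pathMatrix k G R w x y ∈ part k (Bosonization k G R) n := by
  induction hw using Submodule.pow_induction_on_left' generalizing x with
  | algebraMap c =>
    rw [AlgHom.commutes, part, pow_zero, Matrix.algebraMap_matrix_apply]
    split_ifs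
    · exact Submodule.algebraMap_mem c
    · exact zero_mem _
  | add v w i hv hw ihv ihw => rw [map_add]; exact add_mem (ihv x) (ihw x)
  | mem_mul m hm i w hw ih =>
    obtain ⟨r, rfl⟩ := hm
    rw [map_mul, Matrix.mul_apply, part, pow_succ']
    refine Submodule.sum_mem _ fun z _ => Submodule.mul_mem_mul ?_ (ih z)
    rw [pathMatrix_ι]
    exact ⟨_, rfl⟩

/-- Forgetting the vertices of a lifted path returns the word, and the path over a homogeneous word
that ends at 1 starts at the total degree of the word. Hence w ↦ P(w)₁₁, for P = `pathMatrix`, is a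
section over the part of trivial degree. -/
theorem map_forget_pathMatrix (w : Cobar k R) (x : G) :
    Cobar.map (forget k G R) (pathMatrix k G R w x 1) = degreeProj k x w := by
  induction w using induction_hom k G (V := augIdeal k R) generalizing x with
  | h1 =>
    rw [map_one, Matrix.one_apply, degreeProj_one]
    split_ifs <;> simp
  | hsmul c w hw => simp only [map_smul, Matrix.smul_apply, hw]
  | hadd v w hv hw => simp only [map_add, Matrix.add_apply, hv, hw]
  | hmul h r w hr hw =>
    rw [pathMatrix_ι_mul hr, degreeProj_mul (ι_mem hr), map_mul, hw, map_ι, augMap_forget_ofAug]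

/-- Paths from x to 1 lie over words of degree x, so the other homogeneous parts of w do not
contribute. -/
theorem pathMatrix_degreeProj (w : Cobar k R) (x : G) :
    pathMatrix k G R (degreeProj k x w) x 1 = pathMatrix k G R w x 1 := by
  induction w using induction_hom k G (V := augIdeal k R) generalizing x with
  | h1 =>
    rw [degreeProj_one]
    split_ifs with h
    · rfl
    · simp [h]
  | hsmul c w hw => simp only [map_smul, Matrix.smul_apply, hw]
  | hadd v w hv hw => simp only [map_add, Matrix.add_apply, hv, hw]
  | hmul h r w hr hw =>
    rw [degreeProj_mul (ι_mem hr), pathMatrix_ι_mul hr, hw, pathMatrix_ι_mul hr]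

end Bosonization

/-! ### The contracting homotopy onto paths. -/

namespace Bosonization
open GroupComodule YetterDrinfeld TensorAlgebra Cobar

variable {k G R : Type*} [Field k] [Group G] [Ring R] [Algebra k R] [YetterDrinfeld k G R]
  [Coalgebra k R] [BraidedBialgebra k G R] [IsCoaugmented k R] [IsComoduleCoalgebra k G R]
  [Fintype G] [DecidableEq G]

variable (k R) in
/-- The part of `c` of degree `x y⁻¹` in `R⁺ # y`. -/
def block (x y : G) : augIdeal k (Bosonization k G R) →ₗ[k] augIdeal k (Bosonization k G R) :=
  ofAug k R y ∘ₗ degreeProj k (x * y⁻¹) ∘ₗ augProj k R ∘ₗ slice k R y ∘ₗ Submodule.subtype _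

variable (k G R) in
/-- The matrices that encode the recursion `homotopy_ι_mul`. -/
def homotopyMatrix : Cobar k (Bosonization k G R) →ₐ[k]
    Matrix (Option G) (Option G) (Cobar k (Bosonization k G R)) :=
  lift k
    -- The matrices are block triangular and the corner `none` reproduces the word itself. The
    -- column `none` of a product therefore unfolds into a recursion on the first letter; the minus
    -- sign is that of an operator of degree −1 moving past a letter.
    { toFun := fun c => .of fun
        | none, none => ι k c
        | none, some _ => 0
        | some x, none =>
          algebraMap k _ (Coalgebra.counit (slice k R x (c : Bosonization k G R)))
        | some x, some y => -ι k (block k R x y c)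
      map_add' := fun v w => by
        ext i j
        rcases i with _ | i <;> rcases j with _ | j <;> simp [add_comm]
      map_smul' := fun c v => by
        ext i j
        rcases i with _ | i <;> rcases j with _ | j <;>
          simp [Algebra.algebraMap_eq_smul_one, mul_smul] }

theorem homotopyMatrix_none (w : Cobar k (Bosonization k G R)) :
    homotopyMatrix k G R w none none = w ∧
      ∀ x, homotopyMatrix k G R w none (some x) = 0 := by
  induction w using induction_ι_mul with
  | h1 => simp
  | hsmul c w hw => simp [hw]
  | hadd v w hv hw => simp [hv, hw]
  | hmul c w hw =>
    have h1 : homotopyMatrix k G R (ι k c) none none = ι k c := by simp [homotopyMatrix]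
    have h2 : ∀ x, homotopyMatrix k G R (ι k c) none (some x) = 0 := by simp [homotopyMatrix]
    simp [Matrix.mul_apply, Fintype.sum_option, hw, h1, h2]

variable (k R) in
/-- The contracting homotopy from vertex `x`. -/
def homotopy (x : G) : Cobar k (Bosonization k G R) →ₗ[k] Cobar k (Bosonization k G R) :=
  Matrix.entryLinearMap k _ (some x) none ∘ₗ (homotopyMatrix k G R).toLinearMap

theorem homotopy_one (x : G) : homotopy k R x 1 = 0 := by
  simp [homotopy]

/-- A walk that starts at x: the first term deletes the letter c, weighted by its counit coefficient
at the vertex x, and the sum follows the edges in c from x to y and continues from y. -/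
theorem homotopy_ι_mul (x : G) (c : augIdeal k (Bosonization k G R))
    (w : Cobar k (Bosonization k G R)) : homotopy k R x (ι k c * w) =
      Coalgebra.counit (R := k) (slice k R x (c : Bosonization k G R)) • w -
        ∑ y, ι k (block k R x y c) * homotopy k R y w := by
  simp [homotopy, Matrix.mul_apply, Fintype.sum_option, homotopyMatrix_none, Algebra.smul_def,
    sub_eq_add_neg]
  simp [homotopyMatrix]

/-- The slices of 1 # g − 1 # 1 are multiples of 1, which has no component in R⁺. So there is no
edge to follow, and the letter can only be deleted. -/
theorem homotopy_groupElt_mul (x g : G) (w : Cobar k (Bosonization k G R)) :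
    homotopy k R x (ι k (groupElt k R g) * w) =
      ((if g = x then (1 : k) else 0) - if 1 = x then (1 : k) else 0) • w := by
  have h0 : augProj k R 1 = 0 := Subtype.ext (by simp [coe_augProj, IsCoaugmented.counit_one])
  have h1 : ∀ y, block k R x y (groupElt k R g) = 0 := by
    intro y
    simp only [block, LinearMap.comp_apply, Submodule.subtype_apply, coe_groupElt, map_sub,
      slice_of]
    split_ifs <;> simp [h0]
  rw [homotopy_ι_mul, coe_groupElt, map_sub, map_sub, slice_of, slice_of]
  simp only [h1, map_zero, zero_mul, Finset.sum_const_zero, sub_zero]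
  congr 2 <;> split_ifs <;> simp [IsCoaugmented.counit_one]

/-- An edge has counit zero and is never deleted; a walk from x can follow it only if its source y
is x, and goes on from its target z. -/
theorem homotopy_ofAug_mul (x y z : G) (r : augIdeal k R) (w : Cobar k (Bosonization k G R)) :
    homotopy k R x (ι k (ofAug k R z (degreeProj k (y * z⁻¹) r)) * w) =
      if x = y then -(ι k (ofAug k R z (degreeProj k (y * z⁻¹) r)) * homotopy k R z w) else 0 := by
  have h1 : ∀ u, block k R x u (ofAug k R z (degreeProj k (y * z⁻¹) r)) =
      if z = u then if x = y then ofAug k R z (degreeProj k (y * z⁻¹) r) else 0 else 0 := by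
    intro u
    simp only [block, LinearMap.comp_apply, Submodule.subtype_apply, coe_ofAug, slice_of]
    split_ifs with h1 h2
    · subst h1 h2
      rw [augProj_subtype, degreeProj_of_mem (degreeProj_mem _ r), if_pos rfl]
    · subst h1
      rw [augProj_subtype, degreeProj_of_mem (degreeProj_mem _ r), if_neg, map_zero]
      simpa using Ne.symm h2
    · simp
  rw [homotopy_ι_mul, coe_ofAug, slice_of]
  have h2 : Coalgebra.counit (R := k)
      (if z = x then ((degreeProj k (y * z⁻¹) r : augIdeal k R) : R) else 0) = 0 := by
    split_ifs
    · exact (degreeProj k (y * z⁻¹) r).2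
    · exact map_zero _
  rw [h2, zero_smul, zero_sub]
  simp only [h1]
  split_ifs with h
  · rw [Finset.sum_eq_single z] <;> simp +contextual [eq_comm]
  · simp

/-- Passing two consecutive edges gives the sign (−1)² = 1. This handles the quadratic term in the
differential of an edge. -/
theorem homotopy_pathMatrix_mul (x y z : G) (t : augIdeal k R ⊗[k] augIdeal k R)
    (w : Cobar k (Bosonization k G R)) :
    homotopy k R x (pathMatrix k G R
      (LinearMap.mul' k (Cobar k R) (TensorProduct.map (ι k) (ι k) t)) y z * w) =
    if x = y then pathMatrix k G R
      (LinearMap.mul' k (Cobar k R) (TensorProduct.map (ι k) (ι k) t)) y z * homotopy k R z w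
    else 0 := by
  induction t with
  | zero => simp
  | add a b ha hb =>
    simp only [map_add, Matrix.add_apply, add_mul, ha, hb]
    split_ifs <;> simp
  | tmul a b =>
    simp only [TensorProduct.map_tmul, LinearMap.mul'_apply, map_mul, Matrix.mul_apply,
      Finset.sum_mul, map_sum, pathMatrix_ι, mul_assoc, homotopy_ofAug_mul, if_true]
    split_ifs <;> simp

/-- The induction step for an edge A from y to z. Write e_x = 1 # x − 1 # 1, D_x = d + e_x and h_x =
`homotopy k R x`. If x = y, then D_y(A w) = −B w − A D_z w with B the quadratic part, and h_y turns
A into −A and B into B while moving on to h_z. The B terms cancel, which leaves A times the identity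
for w at z. If x ≠ y, then h_x kills A w, B w and A D_z w, and what remains is h_x((e_x − e_y) A w)
= A w. -/
theorem homotopy_ofAug_mul_eq {z : G} {w : Cobar k (Bosonization k G R)} {u : Cobar k R}
    (hu : d k _ (homotopy k R z w) + ι k (groupElt k R z) * homotopy k R z w +
      homotopy k R z (d k _ w + ι k (groupElt k R z) * w) = w - pathMatrix k G R u z 1)
    (x y : G) (r : augIdeal k R) :
    d k _ (homotopy k R x (ι k (ofAug k R z (degreeProj k (y * z⁻¹) r)) * w)) +
      ι k (groupElt k R x) *
        homotopy k R x (ι k (ofAug k R z (degreeProj k (y * z⁻¹) r)) * w) +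
      homotopy k R x (d k _ (ι k (ofAug k R z (degreeProj k (y * z⁻¹) r)) * w) +
        ι k (groupElt k R x) * (ι k (ofAug k R z (degreeProj k (y * z⁻¹) r)) * w)) =
    ι k (ofAug k R z (degreeProj k (y * z⁻¹) r)) * w - pathMatrix k G R
      (if x = y then ι k (degreeProj k (y * z⁻¹) r) * u else 0) x 1 := by
  have hd := d_ofAug_degreeProj (k := k) (R := R) r y z
  have hB := homotopy_pathMatrix_mul x y z (reducedComul k R r) w
  have hA := homotopy_ofAug_mul x y z r
  have hdR : d k R (ι k r) = -LinearMap.mul' k (Cobar k R)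
      (TensorProduct.map (ι k) (ι k) (reducedComul k R r)) := d_ι r
  have hP : pathMatrix k G R (ι k (degreeProj k (y * z⁻¹) r) * u) y 1 =
      ι k (ofAug k R z (degreeProj k (y * z⁻¹) r)) * pathMatrix k G R (u) z 1 := by
    rw [pathMatrix_ι_mul (degreeProj_mem _ r)]
    simp
  rw [hdR, map_neg, Matrix.neg_apply] at hd
  generalize pathMatrix k G R (LinearMap.mul' k (Cobar k R)
      (TensorProduct.map (ι k) (ι k) (reducedComul k R r))) y z = B at *
  have hs := sign_ι (ofAug k R z (degreeProj k (y * z⁻¹) r))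
  generalize ι k (ofAug k R z (degreeProj k (y * z⁻¹) r)) = A at *
  rw [d_mul, hd, hs, hA, map_add, homotopy_groupElt_mul, if_pos rfl]
  -- The term A · e_z is moved from the differential of A to that of w, where it completes d w to
  -- the twisted differential at z.
  have e1 : (-B - ι k (groupElt k R y) * A - A * ι k (groupElt k R z)) * w + -A * d k _ w =
    -(B * w) - ι k (groupElt k R y) * (A * w) - A * (d k _ w + ι k (groupElt k R z) * w) := by
    noncomm_ring
  rw [e1, map_sub, map_sub, map_neg, hB, hA, homotopy_groupElt_mul]
  by_cases h : x = y
  · subst h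
    simp only [if_true]
    rw [hP, ← mul_sub, ← hu, map_neg, d_mul, hd, hs]
    noncomm_ring
  · simp [if_neg h, if_neg (Ne.symm h), sub_smul]

/-- The homotopy contracts the twisted complex with differential `w ↦ d w + groupElt x * w`
to the image of `pathMatrix`. -/
theorem exists_homotopy (w : Cobar k (Bosonization k G R)) : ∃ u : G → Cobar k R, ∀ x : G,
    d k _ (homotopy k R x w) + ι k (groupElt k R x) * homotopy k R x w +
      homotopy k R x (d k _ w + ι k (groupElt k R x) * w) = w - pathMatrix k G R (u x) x 1 := by
  induction w using induction_ι_mul with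
  | h1 =>
    -- The empty word is the constant path at 1. For x ≠ 1 it is contracted, since deleting the
    -- vertex element at x returns 1.
    refine ⟨fun _ => 1, fun x => ?_⟩
    rw [homotopy_one, d_one, map_one, Matrix.one_apply, zero_add, homotopy_groupElt_mul]
    by_cases h : 1 = x
    · simp [h]
    · simp [h, Ne.symm h]
  | hsmul c w hw =>
    obtain ⟨u, hu⟩ := hw
    refine ⟨c • u, fun x => ?_⟩
    rw [Pi.smul_apply, map_smul (pathMatrix k G R), Matrix.smul_apply, ← smul_sub, ← hu]
    simp only [map_smul, mul_smul_comm, smul_add, map_add]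
  | hadd v w hv hw =>
    obtain ⟨u, hu⟩ := hv
    obtain ⟨u', hu'⟩ := hw
    refine ⟨u + u', fun x => ?_⟩
    rw [Pi.add_apply, map_add (pathMatrix k G R), Matrix.add_apply, add_sub_add_comm, ← hu, ← hu']
    simp only [mul_add, map_add]
    abel
  | hmul c w hw =>
    obtain ⟨u, hu⟩ := hw
    -- The identity to be shown is linear in c, so vertex elements and edges are enough; only edges
    -- use the hypothesis on w.
    induction c using augIdeal_induction with
    | h0 => exact ⟨0, fun x => by simp⟩
    | hadd a b ha hb =>
      obtain ⟨v, hv⟩ := ha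
      obtain ⟨v', hv'⟩ := hb
      refine ⟨v + v', fun x => ?_⟩
      rw [Pi.add_apply, map_add (pathMatrix k G R), Matrix.add_apply, map_add (ι k), add_mul,
        add_sub_add_comm, ← hv, ← hv']
      simp only [mul_add, map_add]
      abel
    | hsmul c a ha =>
      obtain ⟨v, hv⟩ := ha
      refine ⟨c • v, fun x => ?_⟩
      rw [Pi.smul_apply, map_smul (pathMatrix k G R), Matrix.smul_apply, map_smul (ι k),
        smul_mul_assoc, ← smul_sub, ← hv]
      simp only [map_smul, mul_smul_comm, smul_add, map_add]
    | hgrp g =>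
      -- A word that begins with a vertex element is contracted completely, so its path part is 0.
      -- The Maurer–Cartan equation makes the terms cancel, with `h1` covering the vertex 1, where
      -- the twist vanishes.
      refine ⟨0, fun x => ?_⟩
      have h1 : (if 1 = x then (1 : k) else 0) • ι k (groupElt k R x) = 0 := by
        split_ifs with h
        · subst h; rw [groupElt_one, map_zero, smul_zero]
        · rw [zero_smul]
      rw [d_mul, d_ι, sign_ι, dGen_groupElt, neg_mul, neg_mul, mul_assoc, map_add, map_add, map_neg,
        map_neg, homotopy_groupElt_mul, homotopy_groupElt_mul, homotopy_groupElt_mul,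
        homotopy_groupElt_mul, map_smul, Pi.zero_apply, map_zero, Matrix.zero_apply, sub_zero,
        if_pos rfl]
      have h2 : (if 1 = x then (1 : k) else 0) • (ι k (groupElt k R x) * w) = 0 := by
        rw [← smul_mul_assoc, h1, zero_mul]
      by_cases h : g = x
      · subst h
        simp only [if_true, sub_smul, mul_sub, mul_smul_comm, h2, one_smul]
        abel
      · simp only [if_neg h, zero_sub, sub_smul, neg_smul, mul_neg, mul_smul_comm, h2, one_smul]
        abel
    | hof y z r =>
      -- The path part of w at z is prolonged by the edge; it can be reached only from its source y.
      exact ⟨fun x => if x = y then ι k (degreeProj k (y * z⁻¹) r) * u z else 0,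
        fun x => homotopy_ofAug_mul_eq (hu z) x y r⟩

/-- At the vertex 1 the twist is zero, so the homotopy identity becomes the ordinary one, and its
term h(d z) vanishes on a cocycle. -/
theorem exists_of_d_eq_zero {z : Cobar k (Bosonization k G R)} (hz : d k _ z = 0) :
    ∃ (u : Cobar k R) (y : Cobar k (Bosonization k G R)),
      z = pathMatrix k G R u 1 1 + d k _ y := by
  obtain ⟨u, hu⟩ := exists_homotopy z
  refine ⟨u 1, homotopy k R (1 : G) z, ?_⟩
  have h := hu 1
  rw [groupElt_one, hz, map_zero, zero_mul, zero_mul, add_zero, add_zero, map_zero,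
    add_zero] at h
  rw [h, add_sub_cancel]

theorem d_pathMatrix_one (w : Cobar k R) :
    d k _ (pathMatrix k G R w 1 1) = pathMatrix k G R (d k R w) 1 1 := by
  rw [d_pathMatrix, groupElt_one]
  simp

end Bosonization

/-! ### Functoriality of cobar cohomology and homogeneous representatives. -/

namespace CobarCohomology
open GroupComodule TensorAlgebra

section
variable {k C D : Type*} [Field k] [AddCommGroup C] [Module k C] [Coalgebra k C] [One C]
  [IsCoaugmented k C] [AddCommGroup D] [Module k D] [Coalgebra k D] [One D]
  [IsCoaugmented k D]

/-- The map on cocycles induced by a morphism of coaugmented coalgebras. -/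
def cocyclesMap {f : C →ₗc[k] D} (hf : f 1 = 1) : Cobar.cocycles k C →ₐ[k] Cobar.cocycles k D :=
  ((Cobar.map f).comp (Cobar.cocycles k C).val).codRestrict (Cobar.cocycles k D) fun z => by
    have h : Cobar.d k D (Cobar.map f (z : Cobar k C)) = 0 := by
      rw [Cobar.d_map hf, Cobar.mem_cocycles.1 z.2, map_zero]
    exact h

/-- The map on cobar cohomology induced by a morphism of coaugmented coalgebras. -/
def map {f : C →ₗc[k] D} (hf : f 1 = 1) : CobarCohomology k C →ₐ[k] CobarCohomology k D :=
  Ideal.Quotient.liftₐ (Cobar.coboundaries k C) ((mk k D).comp (cocyclesMap hf)) fun z hz => by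
    obtain ⟨y, hy⟩ := Cobar.mem_coboundaries.1 hz
    exact mk_eq_zero.2 ⟨Cobar.map f y, by rw [Cobar.d_map hf, hy]; rfl⟩

theorem map_mk {f : C →ₗc[k] D} (hf : f 1 = 1) (z : Cobar.cocycles k C) :
    map hf (mk k C z) = mk k D (cocyclesMap hf z) := rfl

theorem coe_cocyclesMap {f : C →ₗc[k] D} (hf : f 1 = 1) (z : Cobar.cocycles k C) :
    (cocyclesMap hf z : Cobar k D) = Cobar.map f z := rfl

theorem mk_eq_mk_iff {z z' : Cobar.cocycles k C} :
    mk k C z = mk k C z' ↔ ∃ y, Cobar.d k C y = (z : Cobar k C) - z' := by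
  rw [← sub_eq_zero, ← map_sub, mk_eq_zero, Cobar.mem_coboundaries]
  rfl

theorem mk_mem_degree {n : ℕ} {z : Cobar.cocycles k C} (hz : (z : Cobar k C) ∈ Cobar.part k C n) :
    mk k C z ∈ degree k C n := ⟨z, hz, rfl⟩

theorem map_mem_degree {f : C →ₗc[k] D} (hf : f 1 = 1) {n : ℕ} {x : CobarCohomology k C}
    (hx : x ∈ degree k C n) : map hf x ∈ degree k D n := by
  obtain ⟨z, hz, rfl⟩ := hx
  exact mk_mem_degree (Cobar.map_mem_part f hz)

end

section
variable {k G C : Type*} [Field k] [Group G] [AddCommGroup C] [Module k C]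
  [Coalgebra k C] [One C] [IsCoaugmented k C] [GroupComodule k G C] [IsComoduleCoalgebra k G C]

/-- Taking the coefficient of g commutes both with the inclusion of cocycles into ΩC (`h1`) and with
passing to classes (`h2`). -/
theorem degreeProj_mk (g : G) (z z' : Cobar.cocycles k C)
    (hz : (z' : Cobar k C) = degreeProj k g (z : Cobar k C)) :
    degreeProj k g (mk k C z) = mk k C z' := by
  have h1 : ∀ t : MonoidAlgebra k G ⊗[k] Cobar.cocycles k C,
      TensorProduct.lid k _ ((Finsupp.lapply g ∘ₗ
        (MonoidAlgebra.coeffLinearEquiv k).toLinearMap).rTensor _ (Cobar.inclCocycles k G C t)) =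
      (TensorProduct.lid k _ ((Finsupp.lapply g ∘ₗ
        (MonoidAlgebra.coeffLinearEquiv k).toLinearMap).rTensor _ t) : Cobar.cocycles k C) := by
    intro t
    induction t with
    | zero => simp
    | add a b ha hb => simp only [map_add, ha, hb, Subalgebra.coe_add]
    | tmul a b => simp [Cobar.inclCocycles]
  have h2 : ∀ t : MonoidAlgebra k G ⊗[k] Cobar.cocycles k C,
      TensorProduct.lid k _ ((Finsupp.lapply g ∘ₗ
        (MonoidAlgebra.coeffLinearEquiv k).toLinearMap).rTensor _
          (Algebra.TensorProduct.map (AlgHom.id k _) (mk k C) t)) =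
      mk k C (TensorProduct.lid k _ ((Finsupp.lapply g ∘ₗ
        (MonoidAlgebra.coeffLinearEquiv k).toLinearMap).rTensor _ t)) := by
    intro t
    induction t with
    | zero => simp
    | add a b ha hb => simp only [map_add, ha, hb]
    | tmul a b => simp
  refine (h2 (Cobar.coactCocycles k G C z)).trans (congrArg _ (Subtype.ext ?_))
  rw [← h1, Cobar.incl_coactCocycles, hz]
  rfl

theorem mk_mem_coinvariants {z : Cobar.cocycles k C}
    (hz : (z : Cobar k C) ∈ degreePart k G (Cobar k C) 1) :
    mk k C z ∈ coinvariants k G C := by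
  classical
  change mk k C z ∈ degreePart k G (CobarCohomology k C) 1
  rw [← degreeProj_mk (1 : G) z z (by rw [degreeProj_of_mem hz, if_pos rfl])]
  exact degreeProj_mem _ _

/-- A coinvariant class is fixed by the projection to trivial degree, so any of its cocycles may be
replaced by the trivial-degree part. -/
theorem mk_eq_of_mem_coinvariants {z z' : Cobar.cocycles k C}
    (hz' : (z' : Cobar k C) = degreeProj k (1 : G) (z : Cobar k C))
    (hz : mk k C z ∈ coinvariants k G C) : mk k C z' = mk k C z := by
  classical
  have h : mk k C z ∈ degreePart k G (CobarCohomology k C) 1 := hz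
  rw [← degreeProj_mk (1 : G) z z' hz', degreeProj_of_mem h, if_pos rfl]

end
end CobarCohomology

/-! ### The isomorphism with the coinvariants. -/

namespace Bosonization
open GroupComodule YetterDrinfeld TensorAlgebra CobarCohomology

section
variable {k G R : Type*} [Field k] [Group G] [Ring R] [Algebra k R] [YetterDrinfeld k G R]
  [Coalgebra k R] [BraidedBialgebra k G R] [IsCoaugmented k R] [IsComoduleCoalgebra k G R]
  [Fintype G] [DecidableEq G]

variable (k G R) in
/-- The map on cobar cohomology induced by the projection `R # k[G] → R`. -/
def cohomologyMap : CobarCohomology k (Bosonization k G R) →ₐ[k] CobarCohomology k R :=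
  CobarCohomology.map forget_one

/-- Up to a coboundary a cocycle is a sum of closed paths at 1, and the words under such paths have
trivial degree. -/
theorem cohomologyMap_mem_coinvariants (x : CobarCohomology k (Bosonization k G R)) :
    cohomologyMap k G R x ∈ coinvariants k G R := by
  obtain ⟨z, rfl⟩ := CobarCohomology.mk_surjective k _ x
  obtain ⟨u, y, h⟩ := exists_of_d_eq_zero (Cobar.mem_cocycles.1 z.2)
  have h1 : Cobar.map (forget k G R) (z : Cobar k (Bosonization k G R)) =
      degreeProj k (1 : G) u + Cobar.d k R (Cobar.map (forget k G R) y) := by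
    rw [h, map_add, map_forget_pathMatrix, Cobar.d_map forget_one]
  -- The word u need not be a cocycle, but its trivial-degree part differs from the image of the
  -- cocycle z by a coboundary.
  have h2 : degreeProj k (1 : G) u ∈ Cobar.cocycles k R := by
    have h3 : Cobar.map (forget k G R) (z : Cobar k (Bosonization k G R)) ∈ Cobar.cocycles k R :=
      (cocyclesMap forget_one z).2
    rw [Cobar.mem_cocycles] at *
    rwa [h1, map_add, Cobar.d_d, add_zero] at h3
  have h4 : cohomologyMap k G R (CobarCohomology.mk k _ z) = CobarCohomology.mk k R ⟨_, h2⟩ :=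
    (mk_eq_mk_iff (z := cocyclesMap forget_one z)).2
      ⟨Cobar.map (forget k G R) y, by rw [coe_cocyclesMap, h1, add_sub_cancel_left]⟩
  rw [h4]
  exact mk_mem_coinvariants (degreeProj_mem _ u)

theorem cohomologyMap_injective : Function.Injective (cohomologyMap k G R) := by
  rw [injective_iff_map_eq_zero]
  intro x hx
  obtain ⟨z, rfl⟩ := CobarCohomology.mk_surjective k _ x
  obtain ⟨u, y, h⟩ := exists_of_d_eq_zero (Cobar.mem_cocycles.1 z.2)
  obtain ⟨v, hv⟩ := Cobar.mem_coboundaries.1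
    (mk_eq_zero.1 ((map_mk forget_one z).symm.trans hx))
  rw [coe_cocyclesMap, h, map_add, map_forget_pathMatrix, ← Cobar.d_map forget_one,
    ← sub_eq_iff_eq_add, ← map_sub] at hv
  -- By now `hv` says that v minus the image of y bounds the trivial-degree part of u. Lifting to
  -- closed paths commutes with d and sees only that part of u, so the lift bounds z − d y.
  refine mk_eq_zero.2 ⟨pathMatrix k G R (v - Cobar.map (forget k G R) y) 1 1 + y, ?_⟩
  rw [h, map_add, d_pathMatrix_one, hv, pathMatrix_degreeProj]

/-- The closed paths at 1 over z form a cocycle, which maps to the trivial-degree part of z, and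
this part represents the same class. The explicit form of the lift is recorded because it also
controls the degree. -/
theorem exists_cohomologyMap_eq {z : Cobar.cocycles k R}
    (hz : CobarCohomology.mk k R z ∈ coinvariants k G R) :
    ∃ z' : Cobar.cocycles k (Bosonization k G R),
      (z' : Cobar k (Bosonization k G R)) = pathMatrix k G R z 1 1 ∧
      cohomologyMap k G R (CobarCohomology.mk k _ z') = CobarCohomology.mk k R z := by
  have h : pathMatrix k G R z 1 1 ∈ Cobar.cocycles k (Bosonization k G R) := by
    rw [Cobar.mem_cocycles, d_pathMatrix_one, Cobar.mem_cocycles.1 z.2, map_zero,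
      Matrix.zero_apply]
  exact ⟨⟨_, h⟩, rfl, mk_eq_of_mem_coinvariants (map_forget_pathMatrix _ _) hz⟩

variable (k G R) in
/-- The isomorphism from the cobar cohomology of `R # k[G]` to the coinvariants of the cobar
cohomology of `R`. -/
def cohomologyEquiv :
    CobarCohomology k (Bosonization k G R) ≃ₐ[k] CobarCohomology.coinvariants k G R :=
  AlgEquiv.ofBijective ((cohomologyMap k G R).codRestrict _ cohomologyMap_mem_coinvariants)
    ⟨fun _ _ h => cohomologyMap_injective (congrArg Subtype.val h), fun ⟨ξ, hξ⟩ => by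
      obtain ⟨z, rfl⟩ := CobarCohomology.mk_surjective k _ ξ
      obtain ⟨z', -, h⟩ := exists_cohomologyMap_eq hξ
      exact ⟨CobarCohomology.mk k _ z', Subtype.ext h⟩⟩

theorem cohomologyEquiv_mem_degree_iff (n : ℕ) (x : CobarCohomology k (Bosonization k G R)) :
    x ∈ degree k (Bosonization k G R) n ↔
      (cohomologyEquiv k G R x : CobarCohomology k R) ∈ degree k R n := by
  refine ⟨map_mem_degree forget_one, fun h => ?_⟩
  obtain ⟨z, hz, hzx⟩ := h
  have hzx : CobarCohomology.mk k R z = cohomologyMap k G R x := hzx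
  -- The lift of a representative of word length n has word length n, and by injectivity its class
  -- is x.
  obtain ⟨z', hz', h'⟩ := exists_cohomologyMap_eq (z := z)
    (hzx ▸ cohomologyMap_mem_coinvariants x)
  rw [← cohomologyMap_injective (h'.trans hzx)]
  refine mk_mem_degree ?_
  rw [hz']
  exact pathMatrix_mem_part hz 1 1

end
end Bosonization

end

theorem mainTheorem10 (k G V : Type*) [Field k] [Group G] [Finite G] [AddCommGroup V] [Module k V]
    [YetterDrinfeld k G V] [FiniteDimensional k (NicholsAlgebra k G V)] :
    ∃ Φ : CobarCohomology k (Bosonization k G (NicholsAlgebra k G V)) ≃ₐ[k]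
        CobarCohomology.coinvariants k G (NicholsAlgebra k G V),
      ∀ (n : ℕ) (x : CobarCohomology k (Bosonization k G (NicholsAlgebra k G V))),
        x ∈ CobarCohomology.degree k (Bosonization k G (NicholsAlgebra k G V)) n ↔
          (Φ x : CobarCohomology k (NicholsAlgebra k G V)) ∈
            CobarCohomology.degree k (NicholsAlgebra k G V) n := by
  classical
  -- The matrices are indexed by G and their products are sums over all vertices; this is where the
  -- finiteness of G enters.
  have := Fintype.ofFinite G
  exact ⟨Bosonization.cohomologyEquiv k G _, Bosonization.cohomologyEquiv_mem_degree_iff⟩
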